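/- **Setting.** For agents $x_1,\dots,x_N\in\mathbb R^2$ consider $\dot x_i=\sum_{j=1}^N a(\|x_i-x_j\|)(x_j-x_i)$. In the *original* (Hegselmann–Krause) model $a(r)=1$ for $r\in[0,1)$ and $a(r)=0$ for $r\ge 1$; in the *variant* model $a(r)=1$ for $r\in[0,1]$ and $a(r)=0$ for $r>1$. For an ODE $\dot x=f(x)$ with possibly discontinuous $f$ and $T_0>0$, a *sample-and-hold curve* on $[0,T_0]$ with sampling times $0=t_0<\dots<t_m=T_0$ is a continuous curve with $\dot x(t)=f(x(t_j))$ for $t\in[t_j,t_{j+1})$, $0\le j<m$ (one-sided derivative at $t_j$). A *CLSS solution* on $[0,T_0]$ is a continuous curve $x$ which is a uniform limit of sample-and-hold curves $x_\nu$ with $x_\nu(0)=x(0)$ whose maximal step sizes tend to $0$. A *classical* solution satisfies the ODE at every time of $[0,T_0]$ (one-sided derivatives at the end points); a *Carathéodory* solution is absolutely continuous and satisfies it at almost every time. **(1) Three agents.** Let $x_1(0)=(0,0)$, $x_2(0)=(1,0)$, $x_3(0)=(\tfrac13,1)$. For every $T_0>\tfrac12\log 3$ the variant model has two distinct CLSS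 solutions on $[0,T_0]$ with this initial datum. For every $T_0>0$ the original model has exactly one CLSS solution on $[0,T_0]$ with this initial datum. **(2) Ten agents, original model.** Let $\varepsilon=\tfrac1{10}$, $T=\tfrac1{100}$, $B=\tfrac{127}{10\sqrt{91}}$, $a=\tfrac12-2\varepsilon$, $c=B-\sqrt{1-a^2}$, and take the initial datum $$x_1(0)=(0,B-ce^{2T}),\quad x_2(0)=(0,B+ce^{2T}),\quad x_{3,4,5,6}(0)=(ae^{8T},0),\quad x_{7,8,9,10}(0)=(-ae^{8T},0).$$ Let $x(t)$ be the curve $$x_1=(0,B-ce^{2T-2t}),\quad x_2=(0,B+ce^{2T-2t}),\quad x_{3,4,5,6}=(ae^{8T-8t},0),\quad x_{7,8,9,10}=(-ae^{8T-8t},0),$$ and let $Y=(Y_1,Y_2,Y_3,Y_7)$ be the solution of $$\dot Y_1=-9Y_1+Y_2+4Y_3+4Y_7,\quad \dot Y_2=Y_1-Y_2,\quad \dot Y_3=Y_1-5Y_3+4Y_7,\quad \dot Y_7=Y_1+4Y_3-5Y_7$$ with $Y(0)=(x_1,x_2,x_3,x_7)(T)$. Let $y(t)=x(t)$ for $t\le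 T$ and, for $t>T$, $y_i(t)=Y_i(t-T)$ for $i=1,2$, $y_{3,4,5,6}(t)=Y_3(t-T)$, $y_{7,8,9,10}(t)=Y_7(t-T)$. Then $x$ is a classical and a Carathéodory solution of the original model on every interval $[0,S]$, $S>0$. Moreover, for every integer $r\ge1$, with $\bar T=\tfrac{r+1}{r}T$: * $y$ is a Carathéodory solution on $[0,\bar T]$, and $x$ and $y$ are two distinct CLSS solutions on $[0,\bar T]$ with the above initial datum; * for integers $s\ge3$ let $K=r^2s^2$ and $\Delta t=T/K$. As $s\to\infty$, the sample-and-hold curves on $[0,\bar T]$ started at the initial datum, with uniform step $\Delta t$, converge uniformly on $[0,\bar T]$ to $y$; * with the same $K$, $\Delta t$, the sample-and-hold curves started at the initial datum, with first $K-\sqrt K$ steps of length $\Delta t$, then one step of length $4\sqrt K\,\Delta t$, then $\tfrac Kr-3\sqrt K$ steps of length $\Delta t$, converge uniformly on $[0,\bar T]$ to $x$. -/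

import Mathlib

open Set Filter Topology

namespace HK

noncomputable section

/-! ### Solutions of an autonomous ODE `x' = f x` with a possibly discontinuous `f` -/

section Solutions

variable {E : Type*} [NormedAddCommGroup E] [NormedSpace ℝ E]

/-- `0 = t 0 < t 1 < ⋯ < t m = T`; the values of `t` beyond `m` are irrelevant. -/
structure IsPartition (T : ℝ) (m : ℕ) (t : ℕ → ℝ) : Prop where
  start_eq : t 0 = 0
  end_eq : t m = T
  lt_succ : ∀ j < m, t j < t (j + 1)

/-- `x` is the sample-and-hold curve on `[0, T]` with sampling times `t 0 < ⋯ < t m`: it is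
continuous, and on `[t j, t (j + 1))` its derivative (one-sided at `t j`) is constantly
`f (x (t j))`. -/
structure IsSampleAndHold (f : E → E) (T : ℝ) (m : ℕ) (t : ℕ → ℝ) (x : ℝ → E) : Prop where
  partition : IsPartition T m t
  continuousOn : ContinuousOn x (Icc 0 T)
  hasDeriv : ∀ j < m, ∀ s ∈ Ico (t j) (t (j + 1)),
    HasDerivWithinAt x (f (x (t j))) (Ico (t j) (t (j + 1))) s

/-- Clarke-Ledyaev-Sontag-Subbotin solution on `[0, T]`: a uniform limit of sample-and-hold
curves with the same initial datum, whose mesh sizes tend to `0`. -/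
def IsCLSS (f : E → E) (T : ℝ) (x : ℝ → E) : Prop :=
  ContinuousOn x (Icc 0 T) ∧
  ∃ (m : ℕ → ℕ) (t : ℕ → ℕ → ℝ) (xs : ℕ → ℝ → E),
    (∀ ν, IsSampleAndHold f T (m ν) (t ν) (xs ν)) ∧
    (∀ ν, xs ν 0 = x 0) ∧
    (∀ ε > 0, ∀ᶠ ν in atTop, ∀ j < m ν, t ν (j + 1) - t ν j < ε) ∧
    TendstoUniformlyOn xs x atTop (Icc 0 T)

/-- Classical solution on `[0, T]` (one-sided derivatives at the end points). -/
def IsClassical (f : E → E) (T : ℝ) (x : ℝ → E) : Prop :=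
  ∀ t ∈ Icc 0 T, HasDerivWithinAt x (f (x t)) (Icc 0 T) t

/-- Caratheodory solution on `[0, T]`. -/
def IsCaratheodory (f : E → E) (T : ℝ) (x : ℝ → E) : Prop :=
  AbsolutelyContinuousOnInterval x 0 T ∧
  ∀ᵐ t : ℝ, t ∈ Icc 0 T → HasDerivAt x (f (x t)) t

end Solutions

/-! ### The bounded-confidence models, with unit interaction strength -/

/-- Agents interact when their distance is `< 1`. -/
def originalWeight (r : ℝ) : ℝ := if r < 1 then 1 else 0

/-- Agents interact when their distance is `≤ 1`. -/
def variantWeight (r : ℝ) : ℝ := if r ≤ 1 then 1 else 0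

/-- The velocity field of `N` agents in `ℝⁿ` with interaction weight `a`. -/
def field {N n : ℕ} (a : ℝ → ℝ) (x : Fin N → EuclideanSpace ℝ (Fin n)) :
    Fin N → EuclideanSpace ℝ (Fin n) :=
  fun i => ∑ j, a ‖x i - x j‖ • (x j - x i)

/-- The original Hegselmann-Krause velocity field. -/
def originalField {N n : ℕ} (x : Fin N → EuclideanSpace ℝ (Fin n)) :
    Fin N → EuclideanSpace ℝ (Fin n) :=
  field originalWeight x

/-- The velocity field of the variant model. -/
def variantField {N n : ℕ} (x : Fin N → EuclideanSpace ℝ (Fin n)) :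
    Fin N → EuclideanSpace ℝ (Fin n) :=
  field variantWeight x

/-- The plane `ℝ²` with its Euclidean norm. -/
abbrev Plane : Type := EuclideanSpace ℝ (Fin 2)

/-! ### Three agents -/

/-- Initial datum of the three agents. -/
def threeInit : Fin 3 → Plane := ![!₂[0, 0], !₂[1, 0], !₂[1 / 3, 1]]

/-! ### Ten agents; agent `i` of the usual numbering `1, …, 10` has index `i - 1` -/

/-- `ε = 1/10`. -/
def eps : ℝ := 1 / 10

/-- The contact time `T = 1/100`. -/
def contactTime : ℝ := 1 / 100

/-- `B = 127 / (10 √91)`. -/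
def bary : ℝ := 127 / (10 * √91)

/-- `1/2 - 2ε`. -/
def halfGap : ℝ := 1 / 2 - 2 * eps

/-- `B - √(1 - (1/2 - 2ε)²)`. -/
def vertGap : ℝ := bary - √(1 - halfGap ^ 2)

/-- Initial datum of the ten agents. -/
def tenInit : Fin 10 → Plane := fun i =>
  if i = 0 then !₂[0, bary - vertGap * Real.exp (2 * contactTime)]
  else if i = 1 then !₂[0, bary + vertGap * Real.exp (2 * contactTime)]
  else if i < 6 then !₂[halfGap * Real.exp (8 * contactTime), 0]
  else !₂[-(halfGap * Real.exp (8 * contactTime)), 0]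

/-- The trajectory along which agents `1, 2` never interact with agents `3, …, 10`. -/
def trajX (t : ℝ) : Fin 10 → Plane := fun i =>
  if i = 0 then !₂[0, bary - vertGap * Real.exp (2 * contactTime - 2 * t)]
  else if i = 1 then !₂[0, bary + vertGap * Real.exp (2 * contactTime - 2 * t)]
  else if i < 6 then !₂[halfGap * Real.exp (8 * contactTime - 8 * t), 0]
  else !₂[-(halfGap * Real.exp (8 * contactTime - 8 * t)), 0]

/-- Matrix of the linear dynamics of `(x₁, x₂, x₃, x₇)`, where `x₃` and `x₇` each stand for four
coinciding agents, when all interact except agent `2` with agents `3, …, 10`. Each entry stands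
for the corresponding multiple of the `2 × 2` identity matrix. -/
def clusterMatrix : Matrix (Fin 4) (Fin 4) ℝ :=
  !![-9, 1, 4, 4;
     1, -1, 0, 0;
     1, 0, -5, 4;
     1, 0, 4, -5]

/-- `Y` solves the linear system with matrix `clusterMatrix`, starting from the positions of
agents `1, 2, 3, 7` along `trajX` at the contact time. -/
def IsClusterFlow (Y : ℝ → Fin 4 → Plane) : Prop :=
  Y 0 = ![trajX contactTime 0, trajX contactTime 1, trajX contactTime 2, trajX contactTime 6] ∧
  ∀ t : ℝ, HasDerivAt Y (fun i => ∑ j, clusterMatrix i j • Y t j) t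

/-- The cluster an agent belongs to. -/
def cluster (i : Fin 10) : Fin 4 :=
  if i = 0 then 0 else if i = 1 then 1 else if i < 6 then 2 else 3

/-- The trajectory that follows `trajX` up to the contact time and the cluster flow `Y`
afterwards. -/
def trajY (Y : ℝ → Fin 4 → Plane) (t : ℝ) : Fin 10 → Plane := fun i =>
  if t ≤ contactTime then trajX t i else Y (t - contactTime) (cluster i)

/-- The final time `(r + 1) / r * T`. -/
def horizon (r : ℕ) : ℝ := ((r : ℝ) + 1) / r * contactTime

/-- The uniform grid of step `Δt`. -/
def uniformGrid (Δt : ℝ) (j : ℕ) : ℝ := j * Δt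

/-- The grid with, where `K = q²`, `K - q` steps of length `Δt`, then one step of length
`4 q Δt`, then steps of length `Δt`. -/
def jumpGrid (Δt : ℝ) (q : ℕ) (j : ℕ) : ℝ :=
  if j ≤ q ^ 2 - q then j * Δt else ((j : ℝ) + 4 * q - 1) * Δt

end

end HK

open HK

/-! Sample-and-hold curves only see the field at the sampling points, so the choice of sampling
times decides whether a curve notices a contact that occupies a single instant.

Three agents, variant model. As long as only agents 1 and 2 interact, an Euler step of length `h`
multiplies their gap by `1 - 2 * h`. Agent 1 comes within distance 1 of agent 3 only when it is
exactly below it, at gap `1 / 3`. The step `gapStep n` makes the gap `3 ^ (-2 * j / n)` after `j`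
steps, which equals `1 / 3` precisely when `2 * j = n`. For odd `n` no sample hits the contact and
agent 3 rests forever; for even `n` one does, and agent 3 is pulled down at a definite speed
(`eulerSeq_variant_descends`). By Arzelà–Ascoli both families have limits (`exists_isCLSS_subseq`),
and these differ. In the original model the initial datum is an equilibrium, so all sample-and-hold
curves are constant.

Ten agents. Before contact the configuration is `symConf w v`; the squared distance of agents 1 and
3 exceeds 1 by `symGap w v`. The constants are tuned so that along the flow, where `v = w ^ 4`, this
excess has a double zero at `w = 1` and is otherwise positive: `trajX` touches distance 1 and no
interaction begins. An Euler step has factors `1 - 2 * h` for `w` and `1 - 8 * h` for `v`, and the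
latter is smaller than `(1 - 2 * h) ^ 4` by about `24 * h ^ 2`. With `S` the sum of squared steps,
the excess is thus roughly `2.66 * (w - 1) ^ 2 - 4.32 * S`: it is negative in a window around the
contact time whose width is of the order of the root of `S`, that is of `√K * Δt`. The uniform grid
samples inside the window (`symGap_at_contact`); from then on agent 1 attracts the clusters and the
distance only shrinks (`originalField_eulerSeq_after_contact`), which gives `trajY`. The long step
leaps over the window (`symGap_jumpGrid`), and the limit is `trajX`.

On each phase the field agrees at the samples with one linear field, so convergence reduces to a
Grönwall estimate for a trajectory switching between two Lipschitz fields
(`IsSampleAndHold.dist_le_of_switch`). -/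

namespace HK

/-! ### Partitions, sample-and-hold curves and Euler polygons -/

section General

variable {E : Type*} [NormedAddCommGroup E] [NormedSpace ℝ E]

namespace IsPartition

variable {T : ℝ} {m : ℕ} {t : ℕ → ℝ}

theorem monotone (h : IsPartition T m t) {i j : ℕ} (hij : i ≤ j) (hj : j ≤ m) : t i ≤ t j := by
  induction j, hij using Nat.le_induction with
  | base => exact le_rfl
  | succ k hk ih => exact (ih (by omega)).trans (h.lt_succ k (by omega)).le

theorem mem_Icc (h : IsPartition T m t) {j : ℕ} (hj : j ≤ m) : t j ∈ Icc 0 T :=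
  ⟨h.start_eq ▸ h.monotone (Nat.zero_le j) hj, h.end_eq ▸ h.monotone hj le_rfl⟩

theorem exists_mem_Ico (h : IsPartition T m t) {s : ℝ} (hs : s ∈ Ico 0 T) :
    ∃ j < m, s ∈ Ico (t j) (t (j + 1)) := by
  have key : ∀ k ≤ m, s < t k → ∃ j < k, s ∈ Ico (t j) (t (j + 1)) := by
    intro k
    induction k with
    | zero => intro _ hk; exact absurd hs.1 (not_le.2 (h.start_eq ▸ hk))
    | succ k ih =>
      intro hkm hk
      by_cases hlt : s < t k
      · obtain ⟨j, hj, hjs⟩ := ih (by omega) hlt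
        exact ⟨j, by omega, hjs⟩
      · exact ⟨k, by omega, not_lt.1 hlt, hk⟩
  exact key m le_rfl (h.end_eq ▸ hs.2)

end IsPartition

/-- The values of the Euler scheme for `f` at the grid points `t j`. -/
def eulerSeq (f : E → E) (t : ℕ → ℝ) (x₀ : E) : ℕ → E
  | 0 => x₀
  | j + 1 => eulerSeq f t x₀ j + (t (j + 1) - t j) • f (eulerSeq f t x₀ j)

/-- The Euler polygon for `f` on the grid `t 0, …, t m`. -/
def eulerCurve (f : E → E) (t : ℕ → ℝ) (m : ℕ) (x₀ : E) (s : ℝ) : E :=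
  x₀ + ∑ j ∈ Finset.range m, (min s (t (j + 1)) - min s (t j)) • f (eulerSeq f t x₀ j)

theorem eulerSeq_eq_sum (f : E → E) (t : ℕ → ℝ) (x₀ : E) (k : ℕ) :
    eulerSeq f t x₀ k = x₀ + ∑ j ∈ Finset.range k, (t (j + 1) - t j) • f (eulerSeq f t x₀ j) := by
  induction k with
  | zero => simp [eulerSeq]
  | succ k ih => rw [Finset.sum_range_succ, ← add_assoc, ← ih, eulerSeq]

/-- The coefficient `min s (t (j + 1)) - min s (t j)` is the length of the part of the `j`-th step
lying before `s`: full for earlier steps, zero for later ones, `s - t k` for the current one. -/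
theorem eulerCurve_eq (f : E → E) {t : ℕ → ℝ} {m : ℕ} {T : ℝ} (x₀ : E) (h : IsPartition T m t)
    {k : ℕ} (hk : k < m) {s : ℝ} (hs : s ∈ Icc (t k) (t (k + 1))) :
    eulerCurve f t m x₀ s = eulerSeq f t x₀ k + (s - t k) • f (eulerSeq f t x₀ k) := by
  rw [eulerCurve, eulerSeq_eq_sum f t x₀ k, add_assoc, ← Finset.sum_range_add_sum_Ico _ hk.le,
    Finset.sum_eq_sum_Ico_succ_bot hk]
  congr 1
  have h1 : ∑ j ∈ Finset.range k, (min s (t (j + 1)) - min s (t j)) • f (eulerSeq f t x₀ j) =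
      ∑ j ∈ Finset.range k, (t (j + 1) - t j) • f (eulerSeq f t x₀ j) := by
    refine Finset.sum_congr rfl fun j hj => ?_
    have hj := Finset.mem_range.1 hj
    rw [min_eq_right ((h.monotone (show j + 1 ≤ k by omega) hk.le).trans hs.1),
      min_eq_right ((h.monotone hj.le hk.le).trans hs.1)]
  have h2 : ∑ j ∈ Finset.Ico (k + 1) m,
      (min s (t (j + 1)) - min s (t j)) • f (eulerSeq f t x₀ j) = 0 := by
    refine Finset.sum_eq_zero fun j hj => ?_
    have hj := Finset.mem_Ico.1 hj
    rw [min_eq_left (hs.2.trans (h.monotone (show k + 1 ≤ j + 1 by omega) (by omega))),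
      min_eq_left (hs.2.trans (h.monotone hj.1 hj.2.le)), sub_self, zero_smul]
  rw [h1, h2, add_zero, min_eq_left hs.2, min_eq_right hs.1, ← eulerSeq_eq_sum f t x₀ k]

theorem eulerCurve_grid (f : E → E) {t : ℕ → ℝ} {m : ℕ} {T : ℝ} (x₀ : E) (h : IsPartition T m t)
    {k : ℕ} (hk : k ≤ m) : eulerCurve f t m x₀ (t k) = eulerSeq f t x₀ k := by
  rw [eulerCurve, eulerSeq_eq_sum f t x₀ k, ← Finset.sum_range_add_sum_Ico _ hk]
  congr 1
  have h1 : ∑ j ∈ Finset.range k, (min (t k) (t (j + 1)) - min (t k) (t j)) •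
      f (eulerSeq f t x₀ j) = ∑ j ∈ Finset.range k, (t (j + 1) - t j) • f (eulerSeq f t x₀ j) := by
    refine Finset.sum_congr rfl fun j hj => ?_
    have hj := Finset.mem_range.1 hj
    rw [min_eq_right (h.monotone (show j + 1 ≤ k by omega) hk),
      min_eq_right (h.monotone hj.le hk)]
  have h2 : ∑ j ∈ Finset.Ico k m,
      (min (t k) (t (j + 1)) - min (t k) (t j)) • f (eulerSeq f t x₀ j) = 0 := by
    refine Finset.sum_eq_zero fun j hj => ?_
    have hj := Finset.mem_Ico.1 hj
    rw [min_eq_left (h.monotone (show k ≤ j + 1 by omega) (by omega)),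
      min_eq_left (h.monotone hj.1 hj.2.le), sub_self, zero_smul]
  rw [h1, h2, add_zero]

theorem eulerCurve_zero (f : E → E) {t : ℕ → ℝ} {m : ℕ} {T : ℝ} (x₀ : E)
    (h : IsPartition T m t) : eulerCurve f t m x₀ 0 = x₀ := by
  have := eulerCurve_grid f x₀ h (Nat.zero_le m)
  rwa [h.start_eq] at this

theorem isSampleAndHold_eulerCurve (f : E → E) {t : ℕ → ℝ} {m : ℕ} {T : ℝ} (x₀ : E)
    (h : IsPartition T m t) : IsSampleAndHold f T m t (eulerCurve f t m x₀) where
  partition := h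
  continuousOn := by
    apply Continuous.continuousOn
    unfold eulerCurve
    fun_prop
  hasDeriv := by
    intro j hj s hs
    rw [eulerCurve_grid f x₀ h hj.le]
    have h1 : HasDerivAt (fun s : ℝ => eulerSeq f t x₀ j + (s - t j) • f (eulerSeq f t x₀ j))
        (f (eulerSeq f t x₀ j)) s := by
      simpa using (((hasDerivAt_id s).sub_const (t j)).smul_const
        (f (eulerSeq f t x₀ j))).const_add (eulerSeq f t x₀ j)
    exact h1.hasDerivWithinAt.congr
      (fun u hu => eulerCurve_eq f x₀ h hj ⟨hu.1, hu.2.le⟩) (eulerCurve_eq f x₀ h hj ⟨hs.1, hs.2.le⟩)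

/-! ### Estimates for single sample-and-hold curves -/

namespace IsSampleAndHold

variable {f : E → E} {T : ℝ} {m : ℕ} {t : ℕ → ℝ} {x : ℝ → E}

theorem exists_deriv (h : IsSampleAndHold f T m t x) {s : ℝ} (hs : s ∈ Ico 0 T) :
    ∃ j < m, s ∈ Ico (t j) (t (j + 1)) ∧ HasDerivWithinAt x (f (x (t j))) (Ici s) s := by
  obtain ⟨j, hj, hjs⟩ := h.partition.exists_mem_Ico hs
  refine ⟨j, hj, hjs, ((h.hasDeriv j hj s hjs).mono (Ico_subset_Ico_left hjs.1)).mono_of_mem_nhdsWithin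
    (Ico_mem_nhdsGE hjs.2)⟩

theorem norm_sub_le (h : IsSampleAndHold f T m t x) {C : ℝ} (hC : ∀ z, ‖f z‖ ≤ C) {s s' : ℝ}
    (hs : 0 ≤ s) (hss : s ≤ s') (hs' : s' ≤ T) : ‖x s' - x s‖ ≤ C * (s' - s) := by
  have hex : ∀ u : ℝ, ∃ d : E, u ∈ Ico s s' → HasDerivWithinAt x d (Ici u) u ∧ ‖d‖ ≤ C := by
    intro u
    by_cases hu : u ∈ Ico s s'
    · obtain ⟨j, _, _, hd⟩ := h.exists_deriv (s := u) ⟨hs.trans hu.1, hu.2.trans_le hs'⟩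
      exact ⟨_, fun _ => ⟨hd, hC _⟩⟩
    · exact ⟨0, fun hu' => absurd hu' hu⟩
  choose d hd using hex
  exact norm_image_sub_le_of_norm_deriv_right_le_segment
    (h.continuousOn.mono (Icc_subset_Icc hs hs')) (fun u hu => (hd u hu).1)
    (fun u hu => (hd u hu).2) s' ⟨hss, le_rfl⟩

/-- A sample-and-hold curve starting at an equilibrium is constant. -/
theorem eq_of_equilibrium (h : IsSampleAndHold f T m t x) (h0 : f (x 0) = 0) :
    ∀ s ∈ Icc 0 T, x s = x 0 := by
  have key : ∀ k ≤ m, ∀ s ∈ Icc 0 (t k), x s = x 0 := by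
    intro k
    induction k with
    | zero =>
      intro _ s hs
      rw [h.partition.start_eq] at hs
      rw [le_antisymm hs.2 hs.1]
    | succ k ih =>
      intro hk
      have hkT := h.partition.mem_Icc hk
      refine constant_of_has_deriv_right_zero
        (h.continuousOn.mono (Icc_subset_Icc_right hkT.2)) fun u hu => ?_
      obtain ⟨j, hj, hju, hd⟩ := h.exists_deriv (s := u) ⟨hu.1, hu.2.trans_le hkT.2⟩
      have hjk : j ≤ k := by
        by_contra hlt
        exact absurd (hju.1.trans_lt hu.2) (not_lt.2 (h.partition.monotone (by omega) hj.le))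
      rwa [ih (by omega) (t j) ⟨(h.partition.mem_Icc hj.le).1,
        h.partition.monotone hjk (by omega)⟩, h0] at hd
  intro s hs
  exact key m le_rfl s (h.partition.end_eq.symm ▸ hs)

/-- Where the samples follow the vector field `L`, the curve satisfies `x' = L x` up to an error
of the order of the mesh. -/
theorem dist_le_of_exact (h : IsSampleAndHold f T m t x) {C δ : ℝ} (hC : ∀ z, ‖f z‖ ≤ C)
    (hδ : ∀ j < m, t (j + 1) - t j ≤ δ) {L : E → E} {K : NNReal} (hL : LipschitzWith K L)
    {y : ℝ → E} {a b η : ℝ} (ha : 0 ≤ a) (hb : b ≤ T)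
    (hf : ∀ j < m, ∀ s ∈ Ico a b, s ∈ Ico (t j) (t (j + 1)) → f (x (t j)) = L (x (t j)))
    (hyc : ContinuousOn y (Icc a b))
    (hy : ∀ s ∈ Ico a b, HasDerivWithinAt y (L (y s)) (Ici s) s)
    (hη : dist (x a) (y a) ≤ η) :
    ∀ s ∈ Icc a b, dist (x s) (y s) ≤ gronwallBound η K (K * (C * δ)) (s - a) := by
  have hC0 : 0 ≤ C := (norm_nonneg _).trans (hC 0)
  have hex : ∀ u : ℝ, ∃ d : E, u ∈ Ico a b →
      HasDerivWithinAt x d (Ici u) u ∧ dist d (L (x u)) ≤ K * (C * δ) := by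
    intro u
    by_cases hu : u ∈ Ico a b
    · obtain ⟨j, hj, hju, hd⟩ := h.exists_deriv (s := u) ⟨ha.trans hu.1, hu.2.trans_le hb⟩
      refine ⟨_, fun _ => ⟨hd, ?_⟩⟩
      -- The velocity is held at the sample `x (t j)`, from which the curve has moved by at most `C
      -- * δ`; the Lipschitz constant of `L` converts this into the defect.
      rw [hf j hj u hu hju]
      refine (hL.dist_le_mul _ _).trans ?_
      gcongr
      rw [dist_comm, dist_eq_norm]
      refine (h.norm_sub_le hC (h.partition.mem_Icc hj.le).1 hju.1 (hu.2.le.trans hb)).trans ?_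
      gcongr
      linarith [hδ j hj, hju.2]
    · exact ⟨0, fun hu' => absurd hu' hu⟩
  choose d hd using hex
  have := dist_le_of_approx_trajectories_ODE (v := fun _ => L) (K := K) (f := x) (g := y)
    (f' := d) (g' := fun s => L (y s)) (a := a) (b := b) (εf := K * (C * δ)) (εg := 0) (δ := η)
    (fun _ => hL) (h.continuousOn.mono (Icc_subset_Icc ha hb)) (fun u hu => (hd u hu).1)
    (fun u hu => (hd u hu).2) hyc hy (fun u _ => by simp) hη
  simpa using this

end IsSampleAndHold

/-! ### Comparison with switching trajectories, and compactness -/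

theorem gronwallBound_mono_left {δ δ' K ε x : ℝ} (h : δ ≤ δ') :
    gronwallBound δ K ε x ≤ gronwallBound δ' K ε x := by
  unfold gronwallBound
  split_ifs
  · linarith
  · gcongr

/-- Sample-and-hold curves that follow `L₁` up to a sampling time `t k` close to `τ`, and `L₂`
afterwards, stay close to the trajectory that switches from `L₁` to `L₂` at time `τ`. -/
theorem IsSampleAndHold.dist_le_of_switch {f : E → E} {T : ℝ} {m : ℕ} {t : ℕ → ℝ} {x : ℝ → E}
    (h : IsSampleAndHold f T m t x) {C δ : ℝ} (hC : ∀ z, ‖f z‖ ≤ C) (hδ0 : 0 ≤ δ)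
    (hδ : ∀ j < m, t (j + 1) - t j ≤ δ) {L₁ L₂ : E → E} {K : NNReal}
    (hL₁ : LipschitzWith K L₁) (hL₂ : LipschitzWith K L₂) {y : ℝ → E} {τ : ℝ} (hτ : τ ∈ Icc 0 T)
    (h0 : x 0 = y 0)
    (hyL : ∀ s s', 0 ≤ s → s ≤ s' → s' ≤ T → ‖y s' - y s‖ ≤ C * (s' - s))
    (hyc : ContinuousOn y (Icc 0 T))
    (hy₁ : ∀ s ∈ Ico 0 τ, HasDerivWithinAt y (L₁ (y s)) (Ici s) s)
    (hy₂ : ∀ s ∈ Ico τ T, HasDerivWithinAt y (L₂ (y s)) (Ici s) s)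
    {k : ℕ} (hk : k ≤ m) (hf₁ : ∀ j < k, f (x (t j)) = L₁ (x (t j)))
    (hf₂ : ∀ j, k ≤ j → j < m → f (x (t j)) = L₂ (x (t j))) {s : ℝ} (hs : s ∈ Icc 0 T) :
    dist (x s) (y s) ≤
      gronwallBound (gronwallBound 0 K (K * (C * δ)) T + 2 * C * |t k - τ|) K (K * (C * δ)) T := by
  have hC0 : 0 ≤ C := (norm_nonneg _).trans (hC 0)
  have hε : 0 ≤ K * (C * δ) := by positivity
  have hkT := h.partition.mem_Icc hk
  -- Between `p` and `q` the two curves may follow different fields. There only their speed bound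
  -- `C` is used, which costs `2 * C * |t k - τ|`; Grönwall is applied before `p` and after `q`.
  set p := min (t k) τ with hp
  set q := max (t k) τ with hq
  have hpq : q - p = |t k - τ| := max_sub_min_eq_abs' _ _
  have hp0 : 0 ≤ p := le_min hkT.1 hτ.1
  have hqT : q ≤ T := max_le hkT.2 hτ.2
  have hple : p ≤ q := min_le_max
  set G := gronwallBound 0 K (K * (C * δ)) T with hG
  have hG0 : 0 ≤ G := by
    have := gronwallBound_mono le_rfl hε K.2 (hτ.1.trans hτ.2)
    rwa [gronwallBound_x0] at this
  have hD : 0 ≤ G + 2 * C * |t k - τ| := by positivity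
  have hbig : G + 2 * C * |t k - τ| ≤
      gronwallBound (G + 2 * C * |t k - τ|) K (K * (C * δ)) T := by
    have := gronwallBound_mono hD hε K.2 (hτ.1.trans hτ.2)
    rwa [gronwallBound_x0] at this
  have first : ∀ s ∈ Icc 0 p, dist (x s) (y s) ≤ G := by
    intro s hs
    refine (h.dist_le_of_exact (η := 0) hC hδ hL₁ le_rfl (hple.trans hqT) ?_
      (hyc.mono (Icc_subset_Icc_right (hple.trans hqT)))
      (fun u hu => hy₁ u ⟨hu.1, hu.2.trans_le (min_le_right _ _)⟩) (by simp [h0]) s hs).trans ?_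
    · intro j hj u hu hju
      refine hf₁ j (by_contra fun hjk => ?_)
      exact absurd (hju.1.trans_lt (hu.2.trans_le (min_le_left _ _)))
        (not_lt.2 (h.partition.monotone (not_lt.1 hjk) hj.le))
    · exact gronwallBound_mono le_rfl hε K.2 (by linarith [hs.2])
  have second : ∀ s ∈ Icc p q, dist (x s) (y s) ≤ G + 2 * C * |t k - τ| := by
    intro s hs
    have e1 := h.norm_sub_le hC hp0 hs.1 (hs.2.trans hqT)
    have e2 := hyL p s hp0 hs.1 (hs.2.trans hqT)
    have e3 := first p ⟨hp0, le_rfl⟩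
    rw [dist_eq_norm] at e3 ⊢
    have e4 : x s - y s = (x s - x p) + (x p - y p) - (y s - y p) := by abel
    have e5 : C * (s - p) ≤ C * |t k - τ| := by
      rw [← hpq]; gcongr; exact hs.2
    rw [e4]
    calc _ ≤ ‖x s - x p‖ + ‖x p - y p‖ + ‖y s - y p‖ :=
          (_root_.norm_sub_le _ _).trans (by gcongr; exact norm_add_le _ _)
      _ ≤ _ := by linarith
  rcases le_total s p with hsp | hsp
  · have := first s ⟨hs.1, hsp⟩
    have : 0 ≤ 2 * C * |t k - τ| := by positivity
    linarith
  rcases le_total s q with hsq | hsq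
  · exact (second s ⟨hsp, hsq⟩).trans hbig
  refine (h.dist_le_of_exact hC hδ hL₂ (hp0.trans hple) le_rfl ?_
      (hyc.mono (Icc_subset_Icc_left (hp0.trans hple)))
      (fun u hu => hy₂ u ⟨(le_max_right _ _).trans hu.1, hu.2⟩) (second q ⟨hple, le_rfl⟩)
      s ⟨hsq, hs.2⟩).trans ?_
  · intro j hj u hu hju
    refine hf₂ j (by_contra fun hjk => ?_) hj
    exact absurd (hju.2.trans_le (h.partition.monotone (by omega : j + 1 ≤ k) hk))
      (not_lt.2 ((le_max_left _ _).trans hu.1))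
  · exact gronwallBound_mono hD hε K.2 (by linarith [hs.2, hp0.trans hple])

theorem tendstoUniformlyOn_of_switch {f : E → E} {T : ℝ} {m : ℕ → ℕ} {t : ℕ → ℕ → ℝ}
    {xs : ℕ → ℝ → E} (h : ∀ ν, IsSampleAndHold f T (m ν) (t ν) (xs ν))
    {C : ℝ} (hC : ∀ z, ‖f z‖ ≤ C)
    (hmesh : ∀ ε > 0, ∀ᶠ ν in atTop, ∀ j < m ν, t ν (j + 1) - t ν j < ε)
    {L₁ L₂ : E → E} {K : NNReal}
    (hL₁ : LipschitzWith K L₁) (hL₂ : LipschitzWith K L₂) {y : ℝ → E} {τ : ℝ} (hτ : τ ∈ Icc 0 T)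
    (h0 : ∀ ν, xs ν 0 = y 0)
    (hyL : ∀ s s', 0 ≤ s → s ≤ s' → s' ≤ T → ‖y s' - y s‖ ≤ C * (s' - s))
    (hyc : ContinuousOn y (Icc 0 T))
    (hy₁ : ∀ s ∈ Ico 0 τ, HasDerivWithinAt y (L₁ (y s)) (Ici s) s)
    (hy₂ : ∀ s ∈ Ico τ T, HasDerivWithinAt y (L₂ (y s)) (Ici s) s)
    (hk : ∀ ε > 0, ∀ᶠ ν in atTop, ∃ k ≤ m ν, |t ν k - τ| < ε ∧
      (∀ j < k, f (xs ν (t ν j)) = L₁ (xs ν (t ν j))) ∧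
      (∀ j, k ≤ j → j < m ν → f (xs ν (t ν j)) = L₂ (xs ν (t ν j)))) :
    TendstoUniformlyOn xs y atTop (Icc 0 T) := by
  have hC0 : 0 ≤ C := (norm_nonneg _).trans (hC 0)
  -- `F` is the error bound with mesh and switching delay both at most `ε`; it is continuous and
  -- vanishes at `0`.
  let F : ℝ → ℝ := fun ε =>
    gronwallBound (gronwallBound 0 K (K * (C * ε)) T + 2 * C * ε) K (K * (C * ε)) T
  have hF : Continuous F := by
    by_cases hK : (K : ℝ) = 0
    · simp only [F, hK, gronwallBound_K0]
      fun_prop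
    · simp only [F, gronwallBound_of_K_ne_0 hK]
      fun_prop
  have hF0 : F 0 = 0 := by simp [F, gronwallBound_ε0]
  rw [Metric.tendstoUniformlyOn_iff]
  intro ε hε
  obtain ⟨ρ, hρ, hFρ⟩ : ∃ ρ > 0, F ρ < ε := by
    have h1 : ∀ᶠ u in 𝓝 (0 : ℝ), F u < ε :=
      hF.continuousAt.eventually_lt continuousAt_const (by rwa [hF0])
    obtain ⟨ρ, hρ, hball⟩ := Metric.eventually_nhds_iff.1 h1
    exact ⟨ρ / 2, by positivity, hball (by simp [abs_of_pos hρ, hρ])⟩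
  filter_upwards [hmesh ρ hρ, hk ρ hρ] with ν hν hkν s hs
  obtain ⟨k, hkm, hkτ, hf₁, hf₂⟩ := hkν
  rw [dist_comm]
  refine lt_of_le_of_lt (((h ν).dist_le_of_switch hC hρ.le (fun j hj => (hν j hj).le) hL₁ hL₂ hτ
    (h0 ν) hyL hyc hy₁ hy₂ hkm hf₁ hf₂ hs).trans (gronwallBound_mono_left ?_)) hFρ
  gcongr

/-- The degenerate switch at the final time, `τ = T` and `k = m ν`, with the same field twice. -/
theorem tendstoUniformlyOn_of_exact {f : E → E} {T : ℝ} (hT : 0 ≤ T) {m : ℕ → ℕ} {t : ℕ → ℕ → ℝ}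
    {xs : ℕ → ℝ → E} (h : ∀ ν, IsSampleAndHold f T (m ν) (t ν) (xs ν))
    {C : ℝ} (hC : ∀ z, ‖f z‖ ≤ C)
    (hmesh : ∀ ε > 0, ∀ᶠ ν in atTop, ∀ j < m ν, t ν (j + 1) - t ν j < ε)
    {L : E → E} {K : NNReal} (hL : LipschitzWith K L) {y : ℝ → E}
    (h0 : ∀ ν, xs ν 0 = y 0)
    (hyL : ∀ s s', 0 ≤ s → s ≤ s' → s' ≤ T → ‖y s' - y s‖ ≤ C * (s' - s))
    (hyc : ContinuousOn y (Icc 0 T))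
    (hy : ∀ s ∈ Ico 0 T, HasDerivWithinAt y (L (y s)) (Ici s) s)
    (hf : ∀ᶠ ν in atTop, ∀ j < m ν, f (xs ν (t ν j)) = L (xs ν (t ν j))) :
    TendstoUniformlyOn xs y atTop (Icc 0 T) := by
  refine tendstoUniformlyOn_of_switch h hC hmesh hL hL (τ := T) ⟨hT, le_rfl⟩ h0 hyL hyc hy
    (fun s hs => absurd hs.1 (not_le.2 hs.2)) fun ε hε => ?_
  filter_upwards [hf] with ν hν
  exact ⟨m ν, le_rfl, by simpa [(h ν).partition.end_eq] using hε, hν,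
    fun j hj hj' => absurd hj (not_le.2 hj')⟩

/-- Sample-and-hold curves of a bounded vector field with a common initial datum and mesh tending
to `0` have a subsequence converging to a CLSS solution. -/
theorem exists_isCLSS_subseq [FiniteDimensional ℝ E] {f : E → E} {T : ℝ} (hT : 0 ≤ T)
    {m : ℕ → ℕ} {t : ℕ → ℕ → ℝ}
    {xs : ℕ → ℝ → E} (h : ∀ ν, IsSampleAndHold f T (m ν) (t ν) (xs ν))
    {C : ℝ} (hC : ∀ z, ‖f z‖ ≤ C) {x₀ : E} (h0 : ∀ ν, xs ν 0 = x₀)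
    (hmesh : ∀ ε > 0, ∀ᶠ ν in atTop, ∀ j < m ν, t ν (j + 1) - t ν j < ε) :
    ∃ (x : ℝ → E) (φ : ℕ → ℕ), StrictMono φ ∧ x 0 = x₀ ∧ IsCLSS f T x ∧
      TendstoUniformlyOn (fun ν => xs (φ ν)) x atTop (Icc 0 T) := by
  have : ProperSpace E := FiniteDimensional.proper ℝ E
  have hC0 : 0 ≤ C := (norm_nonneg _).trans (hC 0)
  have hlip : ∀ ν, ∀ s ∈ Icc 0 T, ∀ s' ∈ Icc 0 T, dist (xs ν s) (xs ν s') ≤ C * dist s s' := by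
    have aux : ∀ ν, ∀ s ∈ Icc 0 T, ∀ s' ∈ Icc 0 T, s ≤ s' →
        dist (xs ν s) (xs ν s') ≤ C * dist s s' := by
      intro ν s hs s' hs' hss
      rw [dist_comm, dist_eq_norm, dist_comm s, Real.dist_eq, abs_of_nonneg (sub_nonneg.2 hss)]
      exact (h ν).norm_sub_le hC hs.1 hss hs'.2
    intro ν s hs s' hs'
    rcases le_total s s' with hss | hss
    · exact aux ν s hs s' hs' hss
    · rw [dist_comm, dist_comm s]
      exact aux ν s' hs' s hs hss
  let g : ℕ → BoundedContinuousFunction (Icc (0 : ℝ) T) E := fun ν =>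
    BoundedContinuousFunction.mkOfCompact ⟨(Icc 0 T).domRestrict (xs ν), (h ν).continuousOn.domRestrict⟩
  -- Arzelà–Ascoli: all curves are `C`-Lipschitz and start at `x₀`, so they are equicontinuous with
  -- values in a fixed compact ball.
  have hcomp : IsCompact (closure (range g)) := by
    refine BoundedContinuousFunction.arzela_ascoli (Metric.closedBall x₀ (C * T))
      (isCompact_closedBall _ _) _ ?_ ?_
    · rintro _ s ⟨ν, rfl⟩
      have := hlip ν s s.2 0 ⟨le_rfl, hT⟩
      rw [h0, Real.dist_eq, sub_zero, abs_of_nonneg s.2.1] at this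
      exact Metric.mem_closedBall.2 (this.trans (by gcongr; exact s.2.2))
    · have : UniformEquicontinuous ((↑) : range g → Icc (0 : ℝ) T → E) := by
        refine LipschitzWith.uniformEquicontinuous _ ⟨C, hC0⟩ ?_
        rintro ⟨_, ν, rfl⟩
        exact LipschitzWith.of_dist_le_mul fun s s' => hlip ν s s.2 s' s'.2
      exact this.equicontinuous
  obtain ⟨G, _, φ, hφ, hG⟩ := hcomp.tendsto_subseq
    (x := g) (fun ν => subset_closure (mem_range_self ν))
  have hunif : TendstoUniformlyOn (fun ν => xs (φ ν)) (IccExtend hT G) atTop (Icc 0 T) := by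
    rw [BoundedContinuousFunction.tendsto_iff_tendstoUniformly,
      Metric.tendstoUniformly_iff] at hG
    rw [Metric.tendstoUniformlyOn_iff]
    intro ε hε
    filter_upwards [hG ε hε] with ν hν s hs
    rw [IccExtend_of_mem hT G hs]
    exact hν ⟨s, hs⟩
  have hx0 : IccExtend hT G 0 = x₀ := by
    have := hunif.tendsto_at (x := 0) ⟨le_rfl, hT⟩
    simp only [h0] at this
    exact tendsto_nhds_unique this tendsto_const_nhds
  refine ⟨IccExtend hT G, φ, hφ, hx0, ⟨G.continuous.Icc_extend'.continuousOn, m ∘ φ, t ∘ φ,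
    xs ∘ φ, fun ν => h _, fun ν => (h0 _).trans hx0.symm, fun ε hε => ?_, hunif⟩, hunif⟩
  exact hφ.tendsto_atTop.eventually (hmesh ε hε)

end General

/-! ### Bounded-confidence fields -/

theorem plane_norm_lt_one_iff (u : Plane) : ‖u‖ < 1 ↔ u 0 ^ 2 + u 1 ^ 2 < 1 := by
  rw [EuclideanSpace.norm_eq, Real.sqrt_lt' one_pos]
  simp

theorem plane_norm_le_one_iff (u : Plane) : ‖u‖ ≤ 1 ↔ u 0 ^ 2 + u 1 ^ 2 ≤ 1 := by
  rw [EuclideanSpace.norm_eq, Real.sqrt_le_one]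
  simp

/-- Each of the `N` agents contributes a pull of size at most 1. The global bound provides the
common Lipschitz constant of all sample-and-hold curves. -/
theorem norm_field_le {N n : ℕ} {a : ℝ → ℝ} (ha : ∀ r, 0 ≤ r → |a r| * r ≤ 1)
    (x : Fin N → EuclideanSpace ℝ (Fin n)) : ‖field a x‖ ≤ N := by
  rw [pi_norm_le_iff_of_nonneg (by positivity)]
  intro i
  refine (norm_sum_le _ _).trans ?_
  calc _ ≤ ∑ _j : Fin N, (1 : ℝ) := Finset.sum_le_sum fun j _ => by
        rw [norm_smul, norm_sub_rev (x j), Real.norm_eq_abs]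
        exact ha _ (norm_nonneg _)
    _ = N := by simp

theorem norm_originalField_le {N n : ℕ} (x : Fin N → EuclideanSpace ℝ (Fin n)) :
    ‖originalField x‖ ≤ N :=
  norm_field_le (fun r hr => by unfold originalWeight; split_ifs with h <;> simp; exact h.le) x

theorem norm_variantField_le {N n : ℕ} (x : Fin N → EuclideanSpace ℝ (Fin n)) :
    ‖variantField x‖ ≤ N :=
  norm_field_le (fun r hr => by unfold variantWeight; split_ifs with h <;> simp [h]) x

/-! ### Truncated uniform grids -/

/-- The uniform grid of step `h`, truncated at `T`. -/
noncomputable def cutGrid (T h : ℝ) (j : ℕ) : ℝ := min (j * h) T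

theorem isPartition_cutGrid {T h : ℝ} (hT : 0 ≤ T) (hh : 0 < h) :
    IsPartition T ⌈T / h⌉₊ (cutGrid T h) where
  start_eq := by simp [cutGrid, hT]
  end_eq := min_eq_right ((div_le_iff₀ hh).1 (Nat.le_ceil _))
  lt_succ j hj := by
    have h1 : j * h < T := (lt_div_iff₀ hh).1 (Nat.lt_ceil.1 hj)
    unfold cutGrid
    rw [min_eq_left h1.le]
    refine lt_min ?_ h1
    push_cast
    linarith

theorem cutGrid_sub_le {T h : ℝ} (hh : 0 ≤ h) (j : ℕ) :
    cutGrid T h (j + 1) - cutGrid T h j ≤ h := by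
  unfold cutGrid
  have : ((j + 1 : ℕ) : ℝ) * h = j * h + h := by push_cast; ring
  rw [this]
  rcases le_total (j * h) T with h1 | h1
  · rw [min_eq_left h1]
    linarith [min_le_left (j * h + h) T]
  · rw [min_eq_right h1]
    linarith [min_le_right (j * h + h) T]

theorem eulerSeq_cutGrid_succ {E : Type*} [NormedAddCommGroup E] [NormedSpace ℝ E] (f : E → E)
    (x₀ : E) {T h : ℝ} (hh : 0 ≤ h) {j : ℕ} (hj : ((j + 1 : ℕ) : ℝ) * h ≤ T) :
    eulerSeq f (cutGrid T h) x₀ (j + 1) =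
      eulerSeq f (cutGrid T h) x₀ j + h • f (eulerSeq f (cutGrid T h) x₀ j) := by
  have h1 : cutGrid T h (j + 1) - cutGrid T h j = h := by
    unfold cutGrid
    rw [min_eq_left hj, min_eq_left]
    · push_cast; ring
    · push_cast at hj; linarith
  rw [eulerSeq, h1]

/-! ### Three agents, original model -/

/-- Agents 1 and 2 are at distance exactly 1, which does not count as interaction here, and both
other distances exceed 1. -/
theorem originalField_threeInit : originalField threeInit = 0 := by
  have key : ∀ i j, originalWeight ‖threeInit i - threeInit j‖ • (threeInit j - threeInit i) = 0 := by
    intro i j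
    by_cases hij : i = j
    · simp [hij]
    · have : ¬ ‖threeInit i - threeInit j‖ < 1 := by
        rw [plane_norm_lt_one_iff]
        fin_cases i <;> fin_cases j <;> first | exact absurd rfl hij | (norm_num [threeInit])
      rw [originalWeight, if_neg this, zero_smul]
  funext i
  simp [originalField, field, key]

theorem three_agents_original (T : ℝ) (hT : 0 < T) :
    ∃ x : ℝ → Fin 3 → Plane, x 0 = threeInit ∧ IsCLSS originalField T x ∧
      ∀ y : ℝ → Fin 3 → Plane, y 0 = threeInit → IsCLSS originalField T y →
        EqOn y x (Icc 0 T) := by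
  have hpart : ∀ ν : ℕ, IsPartition T ⌈T / (1 / ((ν : ℝ) + 1))⌉₊ (cutGrid T (1 / ((ν : ℝ) + 1))) :=
    fun ν => isPartition_cutGrid hT.le (by positivity)
  refine ⟨fun _ => threeInit, rfl, ⟨continuousOn_const, fun ν => ⌈T / (1 / ((ν : ℝ) + 1))⌉₊,
    fun ν => cutGrid T (1 / ((ν : ℝ) + 1)), fun _ _ => threeInit, fun ν => ⟨hpart ν,
      continuousOn_const, fun j _ s _ => ?_⟩, fun _ => rfl, fun ε hε => ?_, ?_⟩, ?_⟩
  · rw [originalField_threeInit]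
    exact hasDerivWithinAt_const _ _ _
  · filter_upwards [tendsto_one_div_add_atTop_nhds_zero_nat.eventually_lt_const hε] with ν hν j _
    exact (cutGrid_sub_le (by positivity) j).trans_lt hν
  · rw [Metric.tendstoUniformlyOn_iff]
    intro ε hε
    simp [hε]
  · rintro y hy0 ⟨_, m, t, ys, hys, hys0, _, hunif⟩ s hs
    have hconst : ∀ ν, ys ν s = threeInit := fun ν => by
      have h0 : ys ν 0 = threeInit := (hys0 ν).trans hy0
      rw [(hys ν).eq_of_equilibrium (by rw [h0, originalField_threeInit]) s hs, h0]
    have := hunif.tendsto_at hs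
    simp only [hconst] at this
    exact tendsto_nhds_unique this tendsto_const_nhds

/-! ### Three agents, variant model -/

/-- Agents `1, 2` on the horizontal axis at distance `d`, agent `3` in its initial position. -/
noncomputable def tri (d : ℝ) : Fin 3 → Plane := ![!₂[(1 - d) / 2, 0], !₂[(1 + d) / 2, 0], !₂[1 / 3, 1]]

/-- The velocity of `tri d` when only agents `1, 2` interact. -/
noncomputable def triVel (d : ℝ) : Fin 3 → Plane := ![!₂[d, 0], !₂[-d, 0], 0]

theorem variantField_eq_of_weights (x : Fin 3 → Plane) {u v w : ℝ}
    (h01 : variantWeight ‖x 0 - x 1‖ = u) (h02 : variantWeight ‖x 0 - x 2‖ = v)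
    (h12 : variantWeight ‖x 1 - x 2‖ = w) :
    variantField x = ![u • (x 1 - x 0) + v • (x 2 - x 0), u • (x 0 - x 1) + w • (x 2 - x 1),
      v • (x 0 - x 2) + w • (x 1 - x 2)] := by
  have h10 := norm_sub_rev (x 0) (x 1) ▸ h01
  have h20 := norm_sub_rev (x 0) (x 2) ▸ h02
  have h21 := norm_sub_rev (x 1) (x 2) ▸ h12
  funext i
  fin_cases i <;> simp [variantField, field, Fin.sum_univ_three, *]

theorem variantWeight_of_le {u : Plane} (h : u 0 ^ 2 + u 1 ^ 2 ≤ 1) : variantWeight ‖u‖ = 1 :=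
  if_pos ((plane_norm_le_one_iff u).2 h)

theorem variantWeight_of_lt {u : Plane} (h : 1 < u 0 ^ 2 + u 1 ^ 2) : variantWeight ‖u‖ = 0 :=
  if_neg fun h' => absurd ((plane_norm_le_one_iff u).1 h') (not_le.2 h)

/-- Agent 3 is at height 1 above the axis, so it interacts only with an agent exactly below it.
Agent 2 never gets there, and agent 1 is there only for `d = 1 / 3`. -/
theorem variantField_tri {d : ℝ} (h0 : 0 ≤ d) (h1 : d ≤ 1) (hd : d ≠ 1 / 3) :
    variantField (tri d) = triVel d := by
  rw [variantField_eq_of_weights (u := 1) (v := 0) (w := 0)]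
  · funext i
    ext k
    fin_cases i <;> fin_cases k <;> simp [tri, triVel] <;> ring
  · apply variantWeight_of_le
    simp only [tri, PiLp.sub_apply, Matrix.cons_val_zero, Matrix.cons_val_one]
    norm_num [abs_le]
    constructor <;> linarith
  · apply variantWeight_of_lt
    have : 0 < ((1 - d) / 2 - 1 / 3) ^ 2 := by
      apply sq_pos_of_ne_zero
      intro h
      apply hd
      linarith
    simpa [tri] using this
  · apply variantWeight_of_lt
    have : 0 < ((1 + d) / 2 - 1 / 3) ^ 2 := by
      apply sq_pos_of_ne_zero
      intro h
      linarith
    simpa [tri] using this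

theorem tri_add_smul (d h : ℝ) : tri d + h • triVel d = tri (d * (1 - 2 * h)) := by
  funext i
  ext k
  fin_cases i <;> fin_cases k <;> simp [tri, triVel] <;> ring

theorem tri_one : tri 1 = threeInit := by
  funext i
  ext k
  fin_cases i <;> fin_cases k <;> simp [tri, threeInit]

/-- The step size for which the gap between agents `1, 2` shrinks by the factor `3 ^ (-2 / n)`. -/
noncomputable def gapStep (n : ℕ) : ℝ := (1 - Real.exp (-(2 * Real.log 3 / n))) / 2

theorem log_three_pos : 0 < Real.log 3 := Real.log_pos (by norm_num)

theorem gapStep_pos {n : ℕ} (hn : 0 < n) : 0 < gapStep n := by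
  have h3 := log_three_pos
  have hn' : (0 : ℝ) < n := by exact_mod_cast hn
  have : Real.exp (-(2 * Real.log 3 / n)) < 1 := by
    rw [Real.exp_lt_one_iff]
    have : 0 < 2 * Real.log 3 / n := by positivity
    linarith
  unfold gapStep
  linarith

theorem gapStep_le (n : ℕ) : gapStep n ≤ Real.log 3 / n := by
  have := Real.add_one_le_exp (-(2 * Real.log 3 / n))
  have e : 2 * Real.log 3 / n = 2 * (Real.log 3 / n) := by ring
  unfold gapStep
  linarith

/-- The gap after `i` steps is `exp (-2 * i * log 3 / n)`, which is `1 / 3` only for `2 * i = n`.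
Hence the formula holds for all `j` when `n` is odd, and up to and including the contact sample when
`n` is even. -/
theorem eulerSeq_variant_eq_tri {T : ℝ} {n : ℕ} (hn : 0 < n) (j : ℕ)
    (hj : j * gapStep n ≤ T) (hne : ∀ i < j, 2 * i ≠ n) :
    eulerSeq variantField (cutGrid T (gapStep n)) threeInit j =
      tri (Real.exp (-(2 * Real.log 3 / n)) ^ j) := by
  have hh := gapStep_pos hn
  have h3 := log_three_pos
  have hn' : (0 : ℝ) < n := by exact_mod_cast hn
  induction j with
  | zero => simp [eulerSeq, tri_one]
  | succ j ih =>
    have hj' : j * gapStep n ≤ T := by push_cast at hj; linarith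
    rw [eulerSeq_cutGrid_succ _ _ hh.le hj, ih hj' fun i hi => hne i (by omega), variantField_tri,
      tri_add_smul]
    · rw [pow_succ]
      congr 2
      unfold gapStep
      ring
    · positivity
    · refine pow_le_one₀ (Real.exp_pos _).le (Real.exp_le_one_iff.2 ?_)
      have : 0 < 2 * Real.log 3 / n := by positivity
      linarith
    · rw [← Real.exp_nat_mul, show (1 / 3 : ℝ) = Real.exp (-Real.log 3) by
        rw [Real.exp_neg, Real.exp_log (by norm_num)]; norm_num]
      intro h
      have h := Real.exp_injective h
      apply hne j (by omega)
      field_simp at h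
      have : (2 * j : ℝ) = n := by linarith
      exact_mod_cast this

/-- The gap between agents `1, 3` does not grow in an Euler step close to the contact position. -/
theorem contact_gap_step {h a0 a1 b0 b1 c0 c1 : ℝ} (h0 : 0 ≤ h) (h1 : h ≤ 1 / 10)
    (hq : -(3 / 100) ≤ a0 - c0) (hq' : a0 - c0 ≤ 3 / 100) (hq1 : a1 - c1 ≤ -(97 / 100))
    (hq1' : -(103 / 100) ≤ a1 - c1) (hr : 1 / 4 ≤ b0 - a0) (hr' : b0 - a0 ≤ 2 / 5)
    (hr1 : -(3 / 100) ≤ b1 - a1) (hr1' : b1 - a1 ≤ 3 / 100)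
    (hd : (a0 - c0) ^ 2 + (a1 - c1) ^ 2 ≤ 1) :
    (a0 + h * (b0 - a0 + (c0 - a0)) - (c0 + h * (a0 - c0))) ^ 2 +
      (a1 + h * (b1 - a1 + (c1 - a1)) - (c1 + h * (a1 - c1))) ^ 2 ≤ 1 := by
  have e0 : a0 + h * (b0 - a0 + (c0 - a0)) - (c0 + h * (a0 - c0)) =
    (a0 - c0) + h * (b0 - a0 - 2 * (a0 - c0)) := by ring
  have e1 : a1 + h * (b1 - a1 + (c1 - a1)) - (c1 + h * (a1 - c1)) =
    (a1 - c1) + h * (b1 - a1 - 2 * (a1 - c1)) := by ring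
  rw [e0, e1]
  generalize a0 - c0 = q0 at *
  generalize a1 - c1 = q1 at *
  -- The separation `q` of agents 1 and 3 becomes `q + h • r` with `r` their relative velocity.
  -- Since `q` is nearly `(0, -1)`, the product `q · r` is below about `-0.95`, and `2 * h * (q ·
  -- r)` outweighs `h ^ 2 * |r| ^ 2` for `h ≤ 1 / 10`.
  obtain ⟨r0, hr0⟩ : ∃ r0, r0 = b0 - a0 - 2 * q0 := ⟨_, rfl⟩
  obtain ⟨r1, hr1⟩ : ∃ r1, r1 = b1 - a1 - 2 * q1 := ⟨_, rfl⟩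
  rw [← hr0, ← hr1]
  have g0 : |q0| ≤ 3 / 100 := abs_le.2 ⟨hq, hq'⟩
  have k0 : |r0| ≤ 1 / 2 := abs_le.2 ⟨by linarith, by linarith⟩
  have f0 : q0 * r0 ≤ 3 / 100 * (1 / 2) := (le_abs_self _).trans (by
    rw [abs_mul]
    exact mul_le_mul g0 k0 (abs_nonneg _) (by norm_num))
  have f1 : 97 / 100 * 1 ≤ -q1 * r1 := mul_le_mul (by linarith) (by linarith) (by norm_num)
    (by linarith)
  have s0 := sq_le_sq' (abs_le.1 k0).1 (abs_le.1 k0).2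
  have s1 := pow_le_pow_left₀ (show 0 ≤ r1 by linarith) (show r1 ≤ 5 / 2 by linarith) 2
  have f2 : h * (r0 ^ 2 + r1 ^ 2) ≤ 1 / 10 * 7 := mul_le_mul h1 (by linarith) (by positivity)
    (by norm_num)
  have := mul_nonneg h0 (show 0 ≤ -2 * (q0 * r0) - 2 * (q1 * r1) - h * (r0 ^ 2 + r1 ^ 2) by linarith)
  linarith

/-- After agents `1, 3` get in contact, agent `3` descends at a definite speed. -/
theorem eulerSeq_variant_descends {T h : ℝ} (h0 : 0 < h) (h1 : h ≤ 1 / 10) {n₀ : ℕ}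
    (hstart : eulerSeq variantField (cutGrid T h) threeInit n₀ = tri (1 / 3)) (i : ℕ)
    (hi : i * h ≤ 1 / 200) (hiT : ((n₀ + i : ℕ) : ℝ) * h ≤ T) :
    let X := eulerSeq variantField (cutGrid T h) threeInit (n₀ + i)
    (|X 0 0 - 1 / 3| ≤ 3 * (i * h) ∧ |X 0 1| ≤ 3 * (i * h)) ∧
    (|X 1 0 - 2 / 3| ≤ 3 * (i * h) ∧ |X 1 1| ≤ 3 * (i * h)) ∧
    (|X 2 0 - 1 / 3| ≤ 3 * (i * h) ∧ |X 2 1 - 1| ≤ 3 * (i * h)) ∧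
    (X 0 0 - X 2 0) ^ 2 + (X 0 1 - X 2 1) ^ 2 ≤ 1 ∧ X 2 1 ≤ 1 - i * h / 2 := by
  induction i with
  | zero =>
    intro X
    have : X = tri (1 / 3) := hstart
    rw [this]
    have e0 : tri (1 / 3) 2 0 = 1 / 3 := rfl
    have e1 : tri (1 / 3) 2 1 = 1 := rfl
    rw [e0, e1]
    norm_num [tri]
  | succ i ih =>
    intro X
    have hi' : i * h ≤ 1 / 200 - h := by push_cast at hi; linarith
    have hiT' : ((n₀ + i : ℕ) : ℝ) * h ≤ T := by push_cast at hiT ⊢; linarith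
    have hX : X = _ := eulerSeq_cutGrid_succ variantField threeInit (j := n₀ + i) h0.le hiT
    obtain ⟨⟨a0, a1⟩, ⟨b0, b1⟩, ⟨c0, c1⟩, hd, hp⟩ := ih (by linarith) hiT'
    set Z := eulerSeq variantField (cutGrid T h) threeInit (n₀ + i)
    have hs0 : 0 ≤ i * h := by positivity
    push_cast
    rw [add_mul, one_mul]
    set s := i * h
    simp only [abs_le] at a0 a1 b0 b1 c0 c1
    rw [variantField_eq_of_weights Z (u := 1) (v := 1) (w := 0)] at hX
    · rw [hX]
      simp only [Pi.add_apply, Pi.smul_apply, PiLp.add_apply, PiLp.smul_apply, PiLp.sub_apply,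
        Matrix.cons_val_zero, Matrix.cons_val_one, Matrix.cons_val, smul_eq_mul, one_smul,
        zero_smul, add_zero]
      -- Coordinate speeds are at most 3, so on a time span of `1 / 200` no coordinate drifts more
      -- than `3 / 200` from the contact position. This keeps the interaction pattern fixed: 1 with
      -- 2 and 1 with 3, but not 2 with 3.
      have hh : ∀ u v : ℝ, -3 ≤ v → v ≤ 3 → |u| ≤ 3 * s → |u + h * v| ≤ 3 * (s + h) := by
        intro u v hv hv' hu
        rw [abs_le] at *
        constructor <;> nlinarith
      refine ⟨⟨?_, ?_⟩, ⟨?_, ?_⟩, ⟨?_, ?_⟩, ?_, ?_⟩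
      · rw [add_sub_right_comm]
        exact hh _ _ (by linarith) (by linarith) (abs_le.2 a0)
      · exact hh _ _ (by linarith) (by linarith) (abs_le.2 a1)
      · rw [add_sub_right_comm]
        exact hh _ _ (by linarith) (by linarith) (abs_le.2 b0)
      · exact hh _ _ (by linarith) (by linarith) (abs_le.2 b1)
      · rw [add_sub_right_comm]
        exact hh _ _ (by linarith) (by linarith) (abs_le.2 c0)
      · rw [add_sub_right_comm]
        exact hh _ _ (by linarith) (by linarith) (abs_le.2 c1)
      · exact contact_gap_step h0.le h1 (by linarith) (by linarith) (by linarith) (by linarith)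
          (by linarith) (by linarith) (by linarith) (by linarith) hd
      · nlinarith [mul_le_mul_of_nonneg_left (show Z 0 1 - Z 2 1 ≤ -(1 / 2) by linarith) h0.le]
    · apply variantWeight_of_le
      simp only [PiLp.sub_apply]
      have k0 := sq_le_sq' (show -(1 / 2) ≤ Z 0 0 - Z 1 0 by linarith) (show _ ≤ 1 / 2 by linarith)
      have k1 := sq_le_sq' (show -(1 / 2) ≤ Z 0 1 - Z 1 1 by linarith) (show _ ≤ 1 / 2 by linarith)
      linarith
    · exact variantWeight_of_le hd
    · apply variantWeight_of_lt
      simp only [PiLp.sub_apply]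
      have k0 := pow_le_pow_left₀ (by norm_num) (show 3 / 10 ≤ Z 1 0 - Z 2 0 by linarith) 2
      have k1 := pow_le_pow_left₀ (by norm_num) (show 97 / 100 ≤ Z 2 1 - Z 1 1 by linarith) 2
      linarith [sub_sq_comm (Z 1 1) (Z 2 1)]

theorem tendsto_gapStep : Tendsto gapStep atTop (𝓝 0) := by
  have : Tendsto (fun n : ℕ => Real.log 3 / (n : ℝ)) atTop (𝓝 0) :=
    tendsto_const_div_atTop_nhds_zero_nat _
  refine tendsto_of_tendsto_of_tendsto_of_le_of_le' tendsto_const_nhds this ?_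
    (Eventually.of_forall gapStep_le)
  filter_upwards [eventually_gt_atTop 0] with n hn using (gapStep_pos hn).le

theorem three_agents_variant (T : ℝ) (hT : Real.log 3 / 2 < T) :
    ∃ x y : ℝ → Fin 3 → Plane, x 0 = threeInit ∧ y 0 = threeInit ∧
      IsCLSS variantField T x ∧ IsCLSS variantField T y ∧ ¬ EqOn x y (Icc 0 T) := by
  have hT0 : 0 < T := by linarith [log_three_pos]
  let curve : ℕ → ℝ → Fin 3 → Plane := fun n =>
    eulerCurve variantField (cutGrid T (gapStep n)) ⌈T / gapStep n⌉₊ threeInit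
  have hpart : ∀ {n : ℕ}, 0 < n → IsPartition T ⌈T / gapStep n⌉₊ (cutGrid T (gapStep n)) :=
    fun hn => isPartition_cutGrid hT0.le (gapStep_pos hn)
  have hlim : ∀ ψ : ℕ → ℕ, Tendsto ψ atTop atTop → (∀ ν, 0 < ψ ν) →
      ∃ (x : ℝ → Fin 3 → Plane) (φ : ℕ → ℕ), StrictMono φ ∧ x 0 = threeInit ∧
        IsCLSS variantField T x ∧
        TendstoUniformlyOn (fun ν => curve (ψ (φ ν))) x atTop (Icc 0 T) := by
    intro ψ hψ hψ0
    refine exists_isCLSS_subseq hT0.le (xs := fun ν => curve (ψ ν))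
      (fun ν => isSampleAndHold_eulerCurve variantField threeInit (hpart (hψ0 ν)))
      norm_variantField_le (fun ν => eulerCurve_zero _ _ (hpart (hψ0 ν))) fun ε hε => ?_
    filter_upwards [(tendsto_gapStep.comp hψ).eventually_lt_const hε] with ν hν j _
    exact (cutGrid_sub_le (gapStep_pos (hψ0 ν)).le j).trans_lt hν
  -- Odd `n`: the contact is never sampled.
  obtain ⟨x, φ, hφ, hx0, hx, hxlim⟩ := hlim (fun ν => 2 * ν + 1)
    (tendsto_atTop_mono (fun ν => by simp only [id]; omega) tendsto_id) fun ν => by omega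
  -- Even `n`: the contact is sampled after `n / 2` steps.
  obtain ⟨y, χ, hχ, hy0, hy, hylim⟩ := hlim (fun ν => 2 * ν + 2)
    (tendsto_atTop_mono (fun ν => by simp only [id]; omega) tendsto_id) fun ν => by omega
  refine ⟨x, y, hx0, hy0, hx, hy, fun hxy => ?_⟩
  have hx3 : ∀ s ∈ Icc 0 T, x s 2 = !₂[1 / 3, 1] := by
    intro s hs
    have h1 : ∀ ν, curve (2 * φ ν + 1) s 2 = !₂[1 / 3, 1] := by
      intro ν
      simp only [curve, eulerCurve, Pi.add_apply, Finset.sum_apply, Pi.smul_apply]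
      rw [Finset.sum_eq_zero]
      · simp [threeInit]
      intro j hj
      have hh := gapStep_pos (n := 2 * φ ν + 1) (by omega)
      have hjT := ((lt_div_iff₀ hh).1 (Nat.lt_ceil.1 (Finset.mem_range.1 hj))).le
      have e1 := eulerSeq_variant_eq_tri (n := 2 * φ ν + 1) (by omega) j hjT
        (fun i _ => by omega)
      have hn' : (0 : ℝ) < (2 * φ ν + 1 : ℕ) := by positivity
      have h3 := log_three_pos
      rw [e1, variantField_tri]
      · simp [triVel]
      · positivity
      · refine pow_le_one₀ (Real.exp_pos _).le (Real.exp_le_one_iff.2 ?_)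
        have : 0 < 2 * Real.log 3 / (2 * φ ν + 1 : ℕ) := by positivity
        linarith
      · rw [← Real.exp_nat_mul, show (1 / 3 : ℝ) = Real.exp (-Real.log 3) by
          rw [Real.exp_neg, Real.exp_log (by norm_num)]; norm_num]
        intro h
        have h := Real.exp_injective h
        field_simp at h
        have h' : (2 * j : ℝ) = (2 * φ ν + 1 : ℕ) := by linarith
        have : 2 * j = 2 * φ ν + 1 := by exact_mod_cast h'
        omega
    have h2 := ((continuous_apply (2 : Fin 3)).tendsto (x s)).comp (hxlim.tendsto_at hs)
    have h3 : ((fun p : Fin 3 → Plane => p 2) ∘ fun ν => curve (2 * φ ν + 1) s) =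
      fun _ => !₂[1 / 3, 1] := funext h1
    rw [h3] at h2
    exact tendsto_nhds_unique h2 tendsto_const_nhds
  -- Contact occurs no later than `log 3 / 2`, so a time of length `δ` remains. With `h < δ / 2`,
  -- agent 3 descends by more than `δ / 4` in it, which contradicts closeness `δ / 8` to a limit in
  -- which it stays at height 1.
  set δ := min (1 / 200) (T - Real.log 3 / 2) with hδ
  have hδ0 : 0 < δ := lt_min (by norm_num) (by linarith)
  rw [Metric.tendstoUniformlyOn_iff] at hylim
  have hψ : Tendsto (fun ν => 2 * χ ν + 2) atTop atTop :=
    tendsto_atTop_mono (fun ν => by have := hχ.id_le ν; simp only [id] at *; omega) tendsto_id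
  obtain ⟨ν, hν1, hν2, hν3⟩ := ((hylim (δ / 8) (by positivity)).and
    (((tendsto_gapStep.comp hψ).eventually_lt_const (show (0 : ℝ) < 1 / 10 by norm_num)).and
    ((tendsto_gapStep.comp hψ).eventually_lt_const (show 0 < δ / 2 by positivity)))).exists
  simp only [Function.comp] at hν2 hν3
  set n₀ := χ ν + 1 with hn₀
  have hn : 2 * χ ν + 2 = 2 * n₀ := by omega
  rw [hn] at hν1 hν2 hν3
  have hh := gapStep_pos (n := 2 * n₀) (by omega)
  have hn0' : (0 : ℝ) < n₀ := by rw [hn₀]; positivity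
  have hle : n₀ * gapStep (2 * n₀) ≤ Real.log 3 / 2 := by
    have := gapStep_le (2 * n₀)
    calc n₀ * gapStep (2 * n₀) ≤ n₀ * (Real.log 3 / (2 * n₀ : ℕ)) := by gcongr
      _ = _ := by push_cast; field_simp
  have hstart : eulerSeq variantField (cutGrid T (gapStep (2 * n₀))) threeInit n₀ = tri (1 / 3) := by
    rw [eulerSeq_variant_eq_tri (by omega) n₀ (by linarith) fun i hi => by omega,
      ← Real.exp_nat_mul]
    congr 1
    rw [show (1 / 3 : ℝ) = Real.exp (-Real.log 3) by
        rw [Real.exp_neg, Real.exp_log (by norm_num)]; norm_num]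
    congr 1
    push_cast
    field_simp
  set h := gapStep (2 * n₀)
  set i := ⌊δ / h⌋₊ with hi
  have hi1 : i * h ≤ δ := (le_div_iff₀ hh).1 (Nat.floor_le (by positivity))
  have hi2 : δ < (i + 1) * h := (div_lt_iff₀ hh).1 (Nat.lt_floor_add_one _)
  have hiT : ((n₀ + i : ℕ) : ℝ) * h ≤ T := by
    have := min_le_right (1 / 200) (T - Real.log 3 / 2)
    push_cast
    linarith
  have hdesc := (eulerSeq_variant_descends hh hν2.le hstart i
    (hi1.trans (min_le_left _ _)) hiT).2.2.2.2
  have hgrid : n₀ + i ≤ ⌈T / h⌉₊ := by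
    have : ((n₀ + i : ℕ) : ℝ) ≤ ⌈T / h⌉₊ := ((le_div_iff₀ hh).2 hiT).trans (Nat.le_ceil _)
    exact_mod_cast this
  have hp : IsPartition T ⌈T / h⌉₊ (cutGrid T h) := hpart (by omega)
  have hmem := hp.mem_Icc hgrid
  have hd := hν1 _ hmem
  rw [← hxy hmem] at hd
  have hd2 := (dist_le_pi_dist _ _ (2 : Fin 3)).trans_lt hd
  change dist _ (eulerCurve variantField (cutGrid T h) ⌈T / h⌉₊ threeInit _ 2) < _ at hd2
  rw [hx3 _ hmem, eulerCurve_grid variantField threeInit hp hgrid, dist_eq_norm] at hd2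
  have hd3 := (PiLp.norm_apply_le _ (1 : Fin 2)).trans_lt hd2
  simp only [PiLp.sub_apply, Real.norm_eq_abs] at hd3
  have hd4 := (abs_lt.1 hd3).2
  simp at hd4
  linarith

noncomputable section

/-! ### Configurations of the ten agents -/

/-- Agents `1, 2` at heights `p₁, p₂` on the vertical axis, agents `3, …, 6` at `(A, p₃)` and
agents `7, …, 10` at `(-A, p₃)`. -/
def conf (A p₁ p₂ p₃ : ℝ) : Fin 10 → Plane :=
  fun i => ![!₂[0, p₁], !₂[0, p₂], !₂[A, p₃], !₂[-A, p₃]] (cluster i)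

theorem sum_cluster {M : Type*} [AddCommGroup M] [Module ℝ M] (φ : Fin 4 → M) :
    ∑ j : Fin 10, φ (cluster j) = φ 0 + φ 1 + (4 : ℝ) • φ 2 + (4 : ℝ) • φ 3 := by
  have h : ∀ j : Fin 10, cluster j = ![0, 1, 2, 2, 2, 2, 3, 3, 3, 3] j := by decide
  simp only [h]
  simp [Fin.sum_univ_succ]
  module

theorem conf_apply_two (A p₁ p₂ p₃ : ℝ) : conf A p₁ p₂ p₃ 2 = !₂[A, p₃] := rfl

theorem conf_add (A p₁ p₂ p₃ A' p₁' p₂' p₃' : ℝ) :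
    conf A p₁ p₂ p₃ + conf A' p₁' p₂' p₃' = conf (A + A') (p₁ + p₁') (p₂ + p₂') (p₃ + p₃') := by
  funext i
  simp only [conf, Pi.add_apply]
  generalize cluster i = k
  ext l
  fin_cases k <;> fin_cases l <;> simp
  ring

theorem smul_conf (h A p₁ p₂ p₃ : ℝ) :
    h • conf A p₁ p₂ p₃ = conf (h * A) (h * p₁) (h * p₂) (h * p₃) := by
  funext i
  simp only [conf, Pi.smul_apply]
  generalize cluster i = k
  ext l
  fin_cases k <;> fin_cases l <;> simp

theorem conf_eq_sum (A p₁ p₂ p₃ : ℝ) : conf A p₁ p₂ p₃ =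
    A • conf 1 0 0 0 + p₁ • conf 0 1 0 0 + p₂ • conf 0 0 1 0 + p₃ • conf 0 0 0 1 := by
  simp [smul_conf, conf_add]

theorem hasDerivAt_conf {A p₁ p₂ p₃ : ℝ → ℝ} {A' p₁' p₂' p₃' s : ℝ} (hA : HasDerivAt A A' s)
    (h₁ : HasDerivAt p₁ p₁' s) (h₂ : HasDerivAt p₂ p₂' s) (h₃ : HasDerivAt p₃ p₃' s) :
    HasDerivAt (fun u => conf (A u) (p₁ u) (p₂ u) (p₃ u)) (conf A' p₁' p₂' p₃') s := by
  have h := (((hA.smul_const (conf 1 0 0 0)).add (h₁.smul_const (conf 0 1 0 0))).add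
    (h₂.smul_const (conf 0 0 1 0))).add (h₃.smul_const (conf 0 0 0 1))
  rw [← conf_eq_sum] at h
  exact h.congr_of_eventuallyEq (Eventually.of_forall fun u => conf_eq_sum _ _ _ _)

theorem originalWeight_of_lt {u : Plane} (h : u 0 ^ 2 + u 1 ^ 2 < 1) : originalWeight ‖u‖ = 1 :=
  if_pos ((plane_norm_lt_one_iff u).2 h)

theorem originalWeight_of_le {u : Plane} (h : 1 ≤ u 0 ^ 2 + u 1 ^ 2) : originalWeight ‖u‖ = 0 :=
  if_neg fun h' => absurd ((plane_norm_lt_one_iff u).1 h') (not_lt.2 h)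

theorem originalField_cluster (P : Fin 4 → Plane) (W : Fin 4 → Fin 4 → ℝ)
    (hW : ∀ k l, k < l → originalWeight ‖P k - P l‖ = W k l) (hs : ∀ k l, W k l = W l k) :
    originalField (fun i : Fin 10 => P (cluster i)) = fun i =>
      W (cluster i) 0 • (P 0 - P (cluster i)) + W (cluster i) 1 • (P 1 - P (cluster i)) +
      (4 : ℝ) • (W (cluster i) 2 • (P 2 - P (cluster i))) +
      (4 : ℝ) • (W (cluster i) 3 • (P 3 - P (cluster i))) := by
  have key : ∀ k l, originalWeight ‖P k - P l‖ • (P l - P k) = W k l • (P l - P k) := by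
    intro k l
    rcases lt_trichotomy k l with h | h | h
    · rw [hW k l h]
    · simp [h]
    · rw [norm_sub_rev, hW l k h, hs]
  funext i
  simp only [originalField, field, key]
  exact sum_cluster fun l => W (cluster i) l • (P l - P (cluster i))

/-- The velocity of a configuration with weight `w` between agent `1` and agents `3, …, 10`, when
agents `1, 2` interact, agents `3, …, 10` interact, and agent `2` does not interact with
`3, …, 10`. -/
theorem originalField_conf {A p₁ p₂ p₃ w : ℝ} (h12 : (p₁ - p₂) ^ 2 < 1) (hA : 4 * A ^ 2 < 1)
    (h23 : 1 ≤ A ^ 2 + (p₂ - p₃) ^ 2)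
    (h13 : w = 1 ∧ A ^ 2 + (p₁ - p₃) ^ 2 < 1 ∨ w = 0 ∧ 1 ≤ A ^ 2 + (p₁ - p₃) ^ 2) :
    originalField (conf A p₁ p₂ p₃) =
      conf (-(8 + w) * A) (p₂ - p₁ + 8 * w * (p₃ - p₁)) (p₁ - p₂) (w * (p₁ - p₃)) := by
  have hw : ∀ u : Plane, u 0 ^ 2 = A ^ 2 → u 1 = p₁ - p₃ → originalWeight ‖u‖ = w := by
    intro u h0 h1
    rcases h13 with ⟨rfl, h⟩ | ⟨rfl, h⟩
    · exact originalWeight_of_lt (by rwa [h0, h1])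
    · exact originalWeight_of_le (by rwa [h0, h1])
  rw [show conf A p₁ p₂ p₃ =
    fun i => ![!₂[0, p₁], !₂[0, p₂], !₂[A, p₃], !₂[-A, p₃]] (cluster i) from rfl,
    originalField_cluster _ ![![1, 1, w, w], ![1, 1, 0, 0], ![w, 0, 1, 1], ![w, 0, 1, 1]]]
  · funext i
    simp only [conf]
    generalize cluster i = k
    ext l
    fin_cases k <;> fin_cases l <;> simp <;> ring
  · intro k l hkl
    fin_cases k <;> fin_cases l <;> first | exact absurd hkl (by decide) | skip
    · exact originalWeight_of_lt (by simpa using h12)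
    · exact hw _ (by simp) (by simp)
    · exact hw _ (by simp) (by simp)
    · exact originalWeight_of_le (by simpa using h23)
    · exact originalWeight_of_le (by simpa using h23)
    · exact originalWeight_of_lt (by
        have : |A + A| < 1 := (sq_lt_one_iff_abs_lt_one _).1 (by linarith [show (A + A) ^ 2 = 4 * A ^ 2 by ring])
        simpa using this)
  · intro k l
    fin_cases k <;> fin_cases l <;> rfl

/-- The linear vector field that agrees with `originalField` on the configurations of
`originalField_conf`. -/
def confField (w : ℝ) : (Fin 10 → Plane) →L[ℝ] (Fin 10 → Plane) :=
  LinearMap.toContinuousLinearMap <| IsLinearMap.mk'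
    (fun x => conf (-(8 + w) * x 2 0) (x 1 1 - x 0 1 + 8 * w * (x 2 1 - x 0 1)) (x 0 1 - x 1 1)
      (w * (x 0 1 - x 2 1)))
    { map_add := fun x y => by
        rw [conf_add]
        simp only [Pi.add_apply, PiLp.add_apply]
        congr 1 <;> ring
      map_smul := fun h x => by
        rw [smul_conf]
        simp only [Pi.smul_apply, PiLp.smul_apply, smul_eq_mul]
        congr 1 <;> ring }

theorem confField_conf (w A p₁ p₂ p₃ : ℝ) : confField w (conf A p₁ p₂ p₃) =
    conf (-(8 + w) * A) (p₂ - p₁ + 8 * w * (p₃ - p₁)) (p₁ - p₂) (w * (p₁ - p₃)) := rfl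

theorem originalField_conf_eq_confField {A p₁ p₂ p₃ w : ℝ} (h12 : (p₁ - p₂) ^ 2 < 1)
    (hA : 4 * A ^ 2 < 1) (h23 : 1 ≤ A ^ 2 + (p₂ - p₃) ^ 2)
    (h13 : w = 1 ∧ A ^ 2 + (p₁ - p₃) ^ 2 < 1 ∨ w = 0 ∧ 1 ≤ A ^ 2 + (p₁ - p₃) ^ 2) :
    originalField (conf A p₁ p₂ p₃) = confField w (conf A p₁ p₂ p₃) := by
  rw [originalField_conf h12 hA h23 h13, confField_conf]

/-! ### The constants -/

theorem halfGap_eq : halfGap = 3 / 10 := by norm_num [halfGap, eps]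

theorem contactTime_eq : contactTime = 1 / 100 := rfl

/-- The height of agent `1` at the contact time. -/
def contactHeight : ℝ := √91 / 10

theorem contactHeight_sq : contactHeight ^ 2 = 91 / 100 := by
  rw [contactHeight, div_pow, Real.sq_sqrt (by norm_num)]
  norm_num

theorem contactHeight_pos : 0 < contactHeight := by unfold contactHeight; positivity

theorem bary_sub_vertGap : bary - vertGap = contactHeight := by
  have : √(1 - halfGap ^ 2) = contactHeight := by
    rw [Real.sqrt_eq_iff_mul_self_eq_of_pos contactHeight_pos, ← pow_two, contactHeight_sq,
      halfGap_eq]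
    norm_num
  rw [vertGap, this]
  ring

theorem contactHeight_mul_bary : contactHeight * bary = 127 / 100 := by
  have : √91 ≠ 0 := by positivity
  unfold contactHeight bary
  field_simp
  norm_num

/-- This is the tangency condition behind the choice of `bary`: `2 * contactHeight * vertGap = 8 *
halfGap ^ 2`, so the first-order change of the distance of agents 1 and 3 vanishes at contact. -/
theorem contactHeight_mul_vertGap : contactHeight * vertGap = 36 / 100 := by
  have h1 := contactHeight_mul_bary
  have h2 := contactHeight_sq
  rw [← bary_sub_vertGap] at *
  linarith

theorem contactHeight_bounds : 9539 / 10000 < contactHeight ∧ contactHeight < 954 / 1000 := by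
  have h1 := contactHeight_sq
  have h2 := contactHeight_pos
  constructor <;> nlinarith

theorem vertGap_bounds : 377 / 1000 < vertGap ∧ vertGap < 378 / 1000 := by
  obtain ⟨h1, h2⟩ := contactHeight_bounds
  have h3 := contactHeight_mul_vertGap
  constructor <;> nlinarith

theorem bary_eq : bary = contactHeight + vertGap := by rw [← bary_sub_vertGap]; ring

/-! ### Symmetric configurations before the contact of agents `1` and `3` -/

/-- The configuration in which the vertical gap of agents `1, 2` is `w` times, and the horizontal
gap of the two clusters is `v` times, the gap at the contact time. -/
def symConf (w v : ℝ) : Fin 10 → Plane :=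
  conf (halfGap * v) (bary - vertGap * w) (bary + vertGap * w) 0

/-- The squared distance of agents `1` and `3` in `symConf w v`, minus `1`. -/
def symGap (w v : ℝ) : ℝ :=
  vertGap ^ 2 * (w - 1) ^ 2 - 72 / 100 * (w - 1) + 9 / 100 * (v ^ 2 - 1)

theorem symGap_eq (w v : ℝ) :
    (halfGap * v) ^ 2 + (bary - vertGap * w - 0) ^ 2 = 1 + symGap w v := by
  have h1 := contactHeight_mul_vertGap
  have h2 := contactHeight_sq
  have e : bary - vertGap * w - 0 = contactHeight - vertGap * (w - 1) := by rw [bary_eq]; ring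
  rw [e, halfGap_eq, symGap]
  linear_combination h2 - 2 * (w - 1) * h1

/-- Within these ranges only the pairs formed by agent 1 and a cluster agent are critical: agents 1
and 2 are less than 1 apart, the clusters too, and agent 2 is higher than 1. -/
theorem originalField_symConf {w v : ℝ} (hw : 0 ≤ w) (hw' : w ≤ 103 / 100) (hv : 0 ≤ v)
    (hv' : v ≤ 6 / 5) (hg : 0 ≤ symGap w v) :
    originalField (symConf w v) = confField 0 (symConf w v) := by
  obtain ⟨c1, c2⟩ := vertGap_bounds
  obtain ⟨b1, b2⟩ := contactHeight_bounds
  have hcw : 0 ≤ vertGap * w := mul_nonneg (by linarith) hw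
  have hcw' : vertGap * w ≤ 378 / 1000 * (103 / 100) :=
    mul_le_mul c2.le hw' hw (by norm_num)
  refine originalField_conf_eq_confField ?_ ?_ ?_ (Or.inr ⟨rfl, ?_⟩)
  · nlinarith
  · rw [halfGap_eq]
    nlinarith
  · have : 1 ≤ bary + vertGap * w - 0 := by rw [bary_eq]; linarith
    nlinarith [sq_nonneg (halfGap * v)]
  · rw [symGap_eq]
    linarith

theorem symConf_euler (w v h : ℝ) : symConf w v + h • confField 0 (symConf w v) =
    symConf (w * (1 - 2 * h)) (v * (1 - 8 * h)) := by
  simp only [symConf, confField_conf, smul_conf, conf_add]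
  congr 1 <;> ring

/-- On the curve `v = w ^ 4` followed by the exact flow, the linear terms `-72 / 100` and `8 * 9 /
100` cancel, leaving a double zero at `w = 1` with a positive cofactor. -/
theorem symGap_pow_nonneg {w : ℝ} (hw : 0 ≤ w) : 0 ≤ symGap w (w ^ 4) := by
  have e : symGap w (w ^ 4) = (w - 1) ^ 2 * (vertGap ^ 2 + 9 / 100 *
      (w ^ 6 + 2 * w ^ 5 + 3 * w ^ 4 + 4 * w ^ 3 + 5 * w ^ 2 + 6 * w + 7)) := by
    rw [symGap]; ring
  rw [e]
  positivity

theorem trajX_eq (t : ℝ) : trajX t = symConf (Real.exp (2 * contactTime - 2 * t))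
    (Real.exp (8 * contactTime - 8 * t)) := by
  funext i
  fin_cases i <;> rfl

theorem tenInit_eq : tenInit = symConf (Real.exp (2 * contactTime))
    (Real.exp (8 * contactTime)) := by
  funext i
  fin_cases i <;> rfl

theorem trajX_zero : trajX 0 = tenInit := by
  rw [trajX_eq, tenInit_eq]
  simp

theorem hasDerivAt_trajX (t : ℝ) : HasDerivAt trajX (confField 0 (trajX t)) t := by
  have e : ∀ k : ℝ, HasDerivAt (fun u => Real.exp (k * contactTime - k * u))
      (-k * Real.exp (k * contactTime - k * t)) t := by
    intro k
    have := (((hasDerivAt_id t).const_mul k).const_sub (k * contactTime)).exp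
    refine this.congr_deriv ?_
    simp
    ring
  have h := hasDerivAt_conf ((e 8).const_mul halfGap) (((e 2).const_mul vertGap).const_sub bary)
    (((e 2).const_mul vertGap).const_add bary) (hasDerivAt_const t (0 : ℝ))
  rw [trajX_eq, symConf, confField_conf, show trajX = _ from funext trajX_eq]
  refine h.congr_deriv ?_
  congr 1 <;> ring

theorem exp_one_div_fifty_lt : Real.exp (1 / 50) < 103 / 100 := by
  have := Real.exp_bound_div_one_sub_of_interval (x := 1 / 50) (by norm_num) (by norm_num)
  exact this.trans_lt (by norm_num)

theorem exp_two_twenty_fifths_lt : Real.exp (2 / 25) < 6 / 5 := by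
  have := Real.exp_bound_div_one_sub_of_interval (x := 2 / 25) (by norm_num) (by norm_num)
  exact this.trans_lt (by norm_num)

theorem originalField_trajX {t : ℝ} (ht : 0 ≤ t) :
    originalField (trajX t) = confField 0 (trajX t) := by
  rw [trajX_eq]
  refine originalField_symConf (Real.exp_pos _).le ?_ (Real.exp_pos _).le ?_ ?_
  · refine (Real.exp_le_exp.2 ?_).trans exp_one_div_fifty_lt.le
    rw [contactTime_eq]; linarith
  · refine (Real.exp_le_exp.2 ?_).trans exp_two_twenty_fifths_lt.le
    rw [contactTime_eq]; linarith
  · have := symGap_pow_nonneg (Real.exp_pos (2 * contactTime - 2 * t)).le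
    rwa [← Real.exp_nat_mul, show ((4 : ℕ) : ℝ) * (2 * contactTime - 2 * t) =
      8 * contactTime - 8 * t by push_cast; ring] at this

/-! ### The cluster flow -/

/-- A configuration written in the eigenmodes of the cluster dynamics: `e₉`, `e₁`, `e₁₀` are the
amplitudes of the eigenvalues `-9`, `-1`, `-10`; for `e₉ = e₁ = e₁₀ = 1` the agents `1, 2` have
heights `p, 9 β`, and the two clusters are at `(A, 0)`, `(-A, 0)`. -/
def modeConf (A β p e₉ e₁ e₁₀ : ℝ) : Fin 10 → Plane :=
  conf (A * e₉) (β - (β - p) / 10 - 9 * ((β - p) / 10) * e₁₀)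
    (β - (β - p) / 10 + 8 * β * e₁ + (β - p) / 10 * e₁₀)
    (β - (β - p) / 10 - β * e₁ + (β - p) / 10 * e₁₀)

theorem symConf_eq_modeConf (w v : ℝ) : symConf w v =
    modeConf (halfGap * v) ((bary + vertGap * w) / 9) (bary - vertGap * w) 1 1 1 := by
  simp only [symConf, modeConf]
  congr 1 <;> ring

theorem confField_modeConf (A β p e₉ e₁ e₁₀ : ℝ) : confField 1 (modeConf A β p e₉ e₁ e₁₀) =
    conf (A * (-9 * e₉)) (-(9 * ((β - p) / 10) * (-10 * e₁₀)))
      (8 * β * (-1 * e₁) + (β - p) / 10 * (-10 * e₁₀))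
      (-(β * (-1 * e₁)) + (β - p) / 10 * (-10 * e₁₀)) := by
  rw [modeConf, confField_conf]
  congr 1 <;> ring

/-- The amplitudes belong to eigenvectors, so an Euler step acts on each separately. The part `β -
(β - p) / 10` common to all heights is the mean height, the mode of eigenvalue 0. -/
theorem modeConf_euler (A β p e₉ e₁ e₁₀ h : ℝ) :
    modeConf A β p e₉ e₁ e₁₀ + h • confField 1 (modeConf A β p e₉ e₁ e₁₀) =
      modeConf A β p (e₉ * (1 - 9 * h)) (e₁ * (1 - h)) (e₁₀ * (1 - 10 * h)) := by
  rw [confField_modeConf]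
  simp only [modeConf, smul_conf, conf_add]
  congr 1 <;> ring

/-- The ranges surround the contact values, about `0.19` for `β` and `0.954` for `p`. In mode
coordinates the vertical distance of agent 1 to the clusters is `β * e₁ + (p - β) * e₁₀`, with both
coefficients positive: decaying amplitudes keep the contact alive. -/
theorem originalField_modeConf {A β p e₉ e₁ e₁₀ : ℝ} (hβ : 187 / 1000 ≤ β) (hβ' : β ≤ 192 / 1000)
    (hp : 948 / 1000 ≤ p) (hp' : p ≤ 97 / 100) (h1 : 98 / 100 ≤ e₁) (h1' : e₁ ≤ 1)
    (h10 : 8 / 10 ≤ e₁₀) (h10' : e₁₀ ≤ 1) (hA : 4 * (A * e₉) ^ 2 < 1)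
    (hg : (A * e₉) ^ 2 + (β * e₁ + (p - β) * e₁₀) ^ 2 < 1) :
    originalField (modeConf A β p e₉ e₁ e₁₀) = confField 1 (modeConf A β p e₉ e₁ e₁₀) := by
  refine originalField_conf_eq_confField ?_ hA ?_ (Or.inl ⟨rfl, ?_⟩)
  · have e : β - (β - p) / 10 - 9 * ((β - p) / 10) * e₁₀ -
      (β - (β - p) / 10 + 8 * β * e₁ + (β - p) / 10 * e₁₀) = (p - β) * e₁₀ - 8 * β * e₁ := by ring
    have u1 : (p - β) * e₁₀ ≤ 8 / 10 * 1 :=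
      mul_le_mul (by linarith) h10' (by linarith) (by norm_num)
    have u2 : 756 / 1000 * (8 / 10) ≤ (p - β) * e₁₀ :=
      mul_le_mul (by linarith) h10 (by norm_num) (by linarith)
    have u3 : β * e₁ ≤ 192 / 1000 * 1 := mul_le_mul hβ' h1' (by linarith) (by norm_num)
    have u4 : 187 / 1000 * (98 / 100) ≤ β * e₁ := mul_le_mul hβ h1 (by norm_num) (by linarith)
    rw [e, sq_lt_one_iff_abs_lt_one, abs_lt]
    constructor <;> linarith
  · have e : β - (β - p) / 10 + 8 * β * e₁ + (β - p) / 10 * e₁₀ -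
      (β - (β - p) / 10 - β * e₁ + (β - p) / 10 * e₁₀) = 9 * (β * e₁) := by ring
    have u4 : 187 / 1000 * (98 / 100) ≤ β * e₁ := mul_le_mul hβ h1 (by norm_num) (by linarith)
    have := pow_le_pow_left₀ zero_le_one (show 1 ≤ 9 * (β * e₁) by linarith) 2
    rw [e]
    linarith [sq_nonneg (A * e₉)]
  · have e : β - (β - p) / 10 - 9 * ((β - p) / 10) * e₁₀ -
      (β - (β - p) / 10 - β * e₁ + (β - p) / 10 * e₁₀) = β * e₁ + (p - β) * e₁₀ := by ring
    rwa [e]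

/-- The configuration at time `t` of the cluster flow. -/
def flowConf (t : ℝ) : Fin 10 → Plane :=
  modeConf halfGap ((bary + vertGap) / 9) contactHeight (Real.exp (-9 * t)) (Real.exp (-1 * t))
    (Real.exp (-10 * t))

theorem flowConf_zero : flowConf 0 = trajX contactTime := by
  rw [trajX_eq, symConf_eq_modeConf, flowConf, ← bary_sub_vertGap]
  simp

theorem hasDerivAt_flowConf (t : ℝ) : HasDerivAt flowConf (confField 1 (flowConf t)) t := by
  have e : ∀ k : ℝ, HasDerivAt (fun u => Real.exp (k * u)) (k * Real.exp (k * t)) t := by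
    intro k
    refine ((hasDerivAt_id t).const_mul k).exp.congr_deriv ?_
    simp
    ring
  rw [flowConf, confField_modeConf]
  exact hasDerivAt_conf ((e (-9)).const_mul halfGap)
    (((e (-10)).const_mul _).const_sub _)
    ((((e (-1)).const_mul _).const_add _).add ((e (-10)).const_mul _))
    ((((e (-1)).const_mul _).const_sub _).add ((e (-10)).const_mul _))

/-- Strict positivity of `t` matters: at `t = 0` the distance of agents 1 and 3 is exactly 1, and it
falls below 1 immediately afterwards. -/
theorem originalField_flowConf {t : ℝ} (ht : 0 < t) (ht' : t ≤ 1 / 100) :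
    originalField (flowConf t) = confField 1 (flowConf t) := by
  obtain ⟨c1, c2⟩ := contactHeight_bounds
  obtain ⟨b1, b2⟩ := vertGap_bounds
  have e9 : Real.exp (-9 * t) < 1 := Real.exp_lt_one_iff.2 (by linarith)
  have e1 : Real.exp (-1 * t) < 1 := Real.exp_lt_one_iff.2 (by linarith)
  have e10 : Real.exp (-10 * t) < 1 := Real.exp_lt_one_iff.2 (by linarith)
  have l1 := Real.add_one_le_exp (-1 * t)
  have l10 := Real.add_one_le_exp (-10 * t)
  have p9 := Real.exp_pos (-9 * t)
  have q9 := pow_lt_pow_left₀ e9 p9.le two_ne_zero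
  have hβ : (bary + vertGap) / 9 = (contactHeight + 2 * vertGap) / 9 := by rw [bary_eq]; ring
  rw [flowConf, hβ]
  refine originalField_modeConf (by linarith) (by linarith) (by linarith) (by linarith)
    (by linarith) e1.le (by linarith) e10.le ?_ ?_
  · rw [halfGap_eq, mul_pow]
    linarith
  · have h1 : 0 ≤ contactHeight - (contactHeight + 2 * vertGap) / 9 := by linarith
    have h2 : 0 ≤ (contactHeight + 2 * vertGap) / 9 := by linarith
    have h3 := mul_le_mul_of_nonneg_left e1.le h2
    have h4 := mul_le_mul_of_nonneg_left e10.le h1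
    have h5 := pow_le_pow_left₀ (by positivity) (add_le_add h3 h4) 2
    have h6 := contactHeight_sq
    have h7 : ((contactHeight + 2 * vertGap) / 9 * 1 +
      (contactHeight - (contactHeight + 2 * vertGap) / 9) * 1) ^ 2 = contactHeight ^ 2 := by ring
    rw [halfGap_eq, mul_pow]
    linarith

/-- The cluster flow. -/
def flowY (t : ℝ) : Fin 4 → Plane := fun k => flowConf t (![0, 1, 2, 6] k)

theorem flowY_cluster (t : ℝ) (i : Fin 10) : flowY t (cluster i) = flowConf t i := by
  unfold flowY flowConf modeConf conf
  congr 1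
  revert i
  decide

theorem isClusterFlow_flowY : IsClusterFlow flowY := by
  constructor
  · funext k
    rw [flowY, flowConf_zero]
    fin_cases k <;> rfl
  · intro t
    rw [hasDerivAt_pi]
    intro k
    have h := hasDerivAt_pi.1 (hasDerivAt_flowConf t) (![0, 1, 2, 6] k)
    refine HasDerivAt.congr_deriv h ?_
    simp only [flowY, flowConf, confField_modeConf, Fin.sum_univ_four]
    ext l
    fin_cases k <;> fin_cases l <;> simp [modeConf, conf, cluster, clusterMatrix] <;> ring

theorem trajY_of_le {t : ℝ} (ht : t ≤ contactTime) : trajY flowY t = trajX t := by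
  funext i
  simp [trajY, ht]

theorem trajY_of_ge {t : ℝ} (ht : contactTime ≤ t) : trajY flowY t = flowConf (t - contactTime) := by
  rcases ht.eq_or_lt with rfl | ht
  · rw [trajY_of_le le_rfl, sub_self, flowConf_zero]
  · funext i
    simp [trajY, not_le.2 ht, flowY_cluster]

/-! ### Euler factors along a grid -/

/-- The product of the Euler factors `1 - k (t (j + 1) - t j)`, normalized to be `1` at the contact
time up to discretization errors. -/
def decay (k : ℝ) (t : ℕ → ℝ) (n : ℕ) : ℝ :=
  Real.exp (k * contactTime) * ∏ j ∈ Finset.range n, (1 - k * (t (j + 1) - t j))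

/-- The sum of the squared step sizes. -/
def sqStep (t : ℕ → ℝ) (n : ℕ) : ℝ := ∑ j ∈ Finset.range n, (t (j + 1) - t j) ^ 2

theorem decay_succ (k : ℝ) (t : ℕ → ℝ) (n : ℕ) :
    decay k t (n + 1) = decay k t n * (1 - k * (t (n + 1) - t n)) := by
  rw [decay, decay, Finset.prod_range_succ, mul_assoc]

theorem decay_nonneg {k : ℝ} {t : ℕ → ℝ} {n : ℕ} (h : ∀ j < n, k * (t (j + 1) - t j) ≤ 1) :
    0 ≤ decay k t n :=
  mul_nonneg (Real.exp_pos _).le (Finset.prod_nonneg fun j hj => by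
    linarith [h j (Finset.mem_range.1 hj)])

theorem decay_le {k : ℝ} {t : ℕ → ℝ} {n : ℕ} (ht : t 0 = 0)
    (h : ∀ j < n, k * (t (j + 1) - t j) ≤ 1) :
    decay k t n ≤ Real.exp (k * contactTime - k * t n) := by
  have h1 : ∏ j ∈ Finset.range n, (1 - k * (t (j + 1) - t j)) ≤
      ∏ j ∈ Finset.range n, Real.exp (-(k * (t (j + 1) - t j))) :=
    Finset.prod_le_prod (fun j hj => by linarith [h j (Finset.mem_range.1 hj)]) fun j _ => by
      linarith [Real.add_one_le_exp (-(k * (t (j + 1) - t j)))]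
  rw [← Real.exp_sum, Finset.sum_neg_distrib, ← Finset.mul_sum, Finset.sum_range_sub, ht,
    sub_zero] at h1
  rw [sub_eq_add_neg, Real.exp_add]
  exact mul_le_mul_of_nonneg_left h1 (Real.exp_pos _).le

theorem one_sub_sum_le_prod {a : ℕ → ℝ} {n : ℕ} (h0 : ∀ j < n, 0 ≤ a j) (h1 : ∀ j < n, a j ≤ 1) :
    1 - ∑ j ∈ Finset.range n, a j ≤ ∏ j ∈ Finset.range n, (1 - a j) := by
  induction n with
  | zero => simp
  | succ n ih =>
    rw [Finset.sum_range_succ, Finset.prod_range_succ]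
    have ih := ih (fun j hj => h0 j (by omega)) fun j hj => h1 j (by omega)
    have hs : 0 ≤ ∑ j ∈ Finset.range n, a j :=
      Finset.sum_nonneg fun j hj => h0 j (by have := Finset.mem_range.1 hj; omega)
    nlinarith [mul_le_mul_of_nonneg_right ih (sub_nonneg.2 (h1 n (by omega))),
      mul_nonneg hs (h0 n (by omega))]

/-- Per step, `exp (2 * h) ≥ 1 + 2 * h` gives `1 - 2 * h ≥ exp (-2 * h) * (1 - 4 * h ^ 2)`. -/
theorem le_decay_two {t : ℕ → ℝ} {n : ℕ} (ht : t 0 = 0) (h0 : ∀ j < n, 0 ≤ t (j + 1) - t j)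
    (h1 : ∀ j < n, t (j + 1) - t j ≤ 1 / 700) :
    Real.exp (2 * contactTime - 2 * t n) * (1 - 4 * sqStep t n) ≤ decay 2 t n := by
  have h2 : ∏ j ∈ Finset.range n, (Real.exp (-(2 * (t (j + 1) - t j))) *
      (1 - 4 * (t (j + 1) - t j) ^ 2)) ≤ ∏ j ∈ Finset.range n, (1 - 2 * (t (j + 1) - t j)) := by
    refine Finset.prod_le_prod (fun j hj => ?_) fun j hj => ?_
    · have := h0 j (Finset.mem_range.1 hj)
      have := h1 j (Finset.mem_range.1 hj)
      exact mul_nonneg (Real.exp_pos _).le (by nlinarith)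
    · have := h0 j (Finset.mem_range.1 hj)
      have := h1 j (Finset.mem_range.1 hj)
      generalize t (j + 1) - t j = h at *
      have e := Real.add_one_le_exp (2 * h)
      rw [Real.exp_neg, inv_mul_le_iff₀ (Real.exp_pos _)]
      nlinarith
  rw [Finset.prod_mul_distrib, ← Real.exp_sum, Finset.sum_neg_distrib, ← Finset.mul_sum,
    Finset.sum_range_sub, ht, sub_zero] at h2
  have h3 := one_sub_sum_le_prod (a := fun j => 4 * (t (j + 1) - t j) ^ 2) (n := n)
    (fun j _ => by positivity) fun j hj => by nlinarith [h0 j hj, h1 j hj]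
  rw [← Finset.mul_sum] at h3
  rw [sub_eq_add_neg (2 * contactTime), Real.exp_add, mul_assoc, decay]
  refine mul_le_mul_of_nonneg_left (le_trans ?_ h2) (Real.exp_pos _).le
  exact mul_le_mul_of_nonneg_left h3 (Real.exp_pos _).le

/-- Since `(1 - 2 * h) ^ 4 = 1 - 8 * h + 24 * h ^ 2 - ⋯`, the true second-order deficit is 24. The
slack `97 / 4 - 24 = 1 / 4` must absorb the cubic term `162 * h`, whence the bound `1 / 700` on the
steps. -/
theorem le_decay_eight {t : ℕ → ℝ} {n : ℕ} (h0 : ∀ j < n, 0 ≤ t (j + 1) - t j)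
    (h1 : ∀ j < n, t (j + 1) - t j ≤ 1 / 700) :
    decay 2 t n ^ 4 * (1 - 97 / 4 * sqStep t n) ≤ decay 8 t n := by
  have h2 : ∏ j ∈ Finset.range n, ((1 - 2 * (t (j + 1) - t j)) ^ 4 *
      (1 - 97 / 4 * (t (j + 1) - t j) ^ 2)) ≤ ∏ j ∈ Finset.range n, (1 - 8 * (t (j + 1) - t j)) := by
    refine Finset.prod_le_prod (fun j hj => ?_) fun j hj => ?_
    · have := h0 j (Finset.mem_range.1 hj)
      have := h1 j (Finset.mem_range.1 hj)
      exact mul_nonneg (by positivity) (by nlinarith)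
    · have p0 := h0 j (Finset.mem_range.1 hj)
      have p1 := h1 j (Finset.mem_range.1 hj)
      generalize t (j + 1) - t j = h at *
      have e : (1 - 2 * h) ^ 4 * (1 - 97 / 4 * h ^ 2) = 1 - 8 * h -
          h ^ 2 * (1 / 4 - 162 * h + 566 * h ^ 2 - 776 * h ^ 3 + 388 * h ^ 4) := by ring
      have e2 : 0 ≤ 1 / 4 - 162 * h + 566 * h ^ 2 - 776 * h ^ 3 + 388 * h ^ 4 := by
        have : 0 ≤ h ^ 2 * (566 - 776 * h) := mul_nonneg (sq_nonneg _) (by linarith)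
        have : 0 ≤ h ^ 4 := by positivity
        nlinarith
      rw [e]
      linarith [mul_nonneg (sq_nonneg h) e2]
  rw [Finset.prod_mul_distrib, Finset.prod_pow] at h2
  have h3 := one_sub_sum_le_prod (a := fun j => 97 / 4 * (t (j + 1) - t j) ^ 2) (n := n)
    (fun j _ => by positivity) fun j hj => by nlinarith [h0 j hj, h1 j hj]
  rw [← Finset.mul_sum] at h3
  rw [decay, decay, mul_pow, mul_assoc, ← Real.exp_nat_mul,
    show ((4 : ℕ) : ℝ) * (2 * contactTime) = 8 * contactTime by push_cast; ring]
  refine mul_le_mul_of_nonneg_left (le_trans ?_ h2) (Real.exp_pos _).le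
  exact mul_le_mul_of_nonneg_left h3 (by positivity)

/-- The matching upper bound, with 23 just below the true deficit 24. -/
theorem decay_eight_le {t : ℕ → ℝ} {n : ℕ} (h0 : ∀ j < n, 0 ≤ t (j + 1) - t j)
    (h1 : ∀ j < n, t (j + 1) - t j ≤ 1 / 700) :
    decay 8 t n ≤ decay 2 t n ^ 4 * Real.exp (-(23 * sqStep t n)) := by
  have h2 : ∏ j ∈ Finset.range n, (1 - 8 * (t (j + 1) - t j)) ≤
      ∏ j ∈ Finset.range n, ((1 - 2 * (t (j + 1) - t j)) ^ 4 *
        Real.exp (-(23 * (t (j + 1) - t j) ^ 2))) := by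
    refine Finset.prod_le_prod (fun j hj => ?_) fun j hj => ?_
    · linarith [h1 j (Finset.mem_range.1 hj)]
    · have p0 := h0 j (Finset.mem_range.1 hj)
      have p1 := h1 j (Finset.mem_range.1 hj)
      generalize t (j + 1) - t j = h at *
      have e := Real.add_one_le_exp (-(23 * h ^ 2))
      refine le_trans ?_ (mul_le_mul_of_nonneg_left e (by positivity))
      have e : (1 - 2 * h) ^ 4 * (-(23 * h ^ 2) + 1) = 1 - 8 * h +
          h ^ 2 * (1 + 152 * h - 536 * h ^ 2 + 736 * h ^ 3 - 368 * h ^ 4) := by ring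
      have e2 : 0 ≤ 1 + 152 * h - 536 * h ^ 2 + 736 * h ^ 3 - 368 * h ^ 4 := by
        have : 0 ≤ h * (152 - 536 * h) := mul_nonneg p0 (by linarith)
        have : 0 ≤ h ^ 3 * (736 - 368 * h) := mul_nonneg (by positivity) (by linarith)
        nlinarith
      rw [e]
      linarith [mul_nonneg (sq_nonneg h) e2]
  rw [Finset.prod_mul_distrib, Finset.prod_pow, ← Real.exp_sum, Finset.sum_neg_distrib,
    ← Finset.mul_sum] at h2
  rw [decay, decay, mul_pow, mul_assoc, ← Real.exp_nat_mul,
    show ((4 : ℕ) : ℝ) * (2 * contactTime) = 8 * contactTime by push_cast; ring]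
  exact mul_le_mul_of_nonneg_left h2 (Real.exp_pos _).le

/-! ### Criteria for the contact of agents `1` and `3` -/

/-- With `x = w - 1` the linear terms cancel, and `28 * 9 / 100 * x ^ 2` dominates the loss `9 / 100
* 97 / 2 * S`, enlarged by at most the factor `13 / 10`. -/
theorem symGap_nonneg_of_one_le {w v S : ℝ} (h0 : 0 ≤ S) (h1 : 1 ≤ w) (h2 : w ≤ 103 / 100)
    (hS : 18 / 5 * S ≤ (w - 1) ^ 2) (hv : w ^ 4 * (1 - 97 / 4 * S) ≤ v) : 0 ≤ symGap w v := by
  obtain ⟨x, rfl⟩ : ∃ x, w = 1 + x := ⟨w - 1, by ring⟩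
  have hx : 0 ≤ x := by linarith
  have hx2 : x ≤ 3 / 100 := by linarith
  rw [add_sub_cancel_left] at hS
  have hx3 : x ^ 2 ≤ (3 / 100) ^ 2 := pow_le_pow_left₀ hx hx2 2
  have hS1 : 0 ≤ 1 - 97 / 4 * S := by linarith
  have hvv := pow_le_pow_left₀ (mul_nonneg (by positivity) hS1) hv 2
  have e1 : 1 + 8 * x + 28 * x ^ 2 ≤ (1 + x) ^ 8 := by
    have : (1 + x) ^ 8 = 1 + 8 * x + 28 * x ^ 2 +
      x ^ 3 * (56 + 70 * x + 56 * x ^ 2 + 28 * x ^ 3 + 8 * x ^ 4 + x ^ 5) := by ring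
    rw [this]
    have : 0 ≤ x ^ 3 * (56 + 70 * x + 56 * x ^ 2 + 28 * x ^ 3 + 8 * x ^ 4 + x ^ 5) := by positivity
    linarith
  have e2 : 1 - 97 / 2 * S ≤ (1 - 97 / 4 * S) ^ 2 := by nlinarith [sq_nonneg S]
  have e3 : (1 + 8 * x + 28 * x ^ 2) * (1 - 97 / 2 * S) ≤ v ^ 2 := by
    refine le_trans ?_ hvv
    rw [mul_pow, ← pow_mul]
    exact mul_le_mul e1 e2 (by linarith) (by positivity)
  have e4 : S * (1 + 8 * x + 28 * x ^ 2) ≤ S * (13 / 10) :=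
    mul_le_mul_of_nonneg_left (by linarith) h0
  rw [symGap, add_sub_cancel_left]
  have := mul_nonneg (sq_nonneg vertGap) (sq_nonneg x)
  nlinarith

/-- The same balance after the contact time. The sharper constant `19 / 10` is needed there because
the long step inflates `S`. -/
theorem symGap_nonneg_of_le_one {w v S : ℝ} (h0 : 0 ≤ S) (h1 : w ≤ 1) (h2 : 97 / 100 ≤ w)
    (hS : 19 / 10 * S ≤ (w - 1) ^ 2) (hv : w ^ 4 * (1 - 97 / 4 * S) ≤ v) : 0 ≤ symGap w v := by
  obtain ⟨x, rfl⟩ : ∃ x, w = 1 - x := ⟨1 - w, by ring⟩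
  have hx : 0 ≤ x := by linarith
  have hx2 : x ≤ 3 / 100 := by linarith
  have hxx : 1 - x - 1 = -x := by ring
  rw [hxx, neg_sq] at hS
  have hx3 : x ^ 2 ≤ (3 / 100) ^ 2 := pow_le_pow_left₀ hx hx2 2
  have hS1 : 0 ≤ 1 - 97 / 4 * S := by linarith
  have hvv := pow_le_pow_left₀ (mul_nonneg (by positivity) hS1) hv 2
  have e1 : 1 - 8 * x + 28 * x ^ 2 - 56 * x ^ 3 ≤ (1 - x) ^ 8 := by
    have : (1 - x) ^ 8 = 1 - 8 * x + 28 * x ^ 2 - 56 * x ^ 3 +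
      x ^ 4 * (70 - 56 * x + x ^ 2 * (28 - 8 * x) + x ^ 4) := by ring
    rw [this]
    have h3 : 0 ≤ x ^ 2 * (28 - 8 * x) := mul_nonneg (sq_nonneg _) (by linarith)
    have : 0 ≤ x ^ 4 * (70 - 56 * x + x ^ 2 * (28 - 8 * x) + x ^ 4) :=
      mul_nonneg (by positivity) (by have : 0 ≤ x ^ 4 := by positivity
                                     linarith)
    linarith
  have e2 : 1 - 97 / 2 * S ≤ (1 - 97 / 4 * S) ^ 2 := by nlinarith [sq_nonneg S]
  have e0 : (1 - x) ^ 8 ≤ 1 := pow_le_one₀ (by linarith) h1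
  have e3 : (1 - x) ^ 8 - 97 / 2 * S ≤ v ^ 2 := by
    refine le_trans ?_ hvv
    rw [mul_pow, ← pow_mul]
    have := mul_le_mul_of_nonneg_left e2 (show 0 ≤ (1 - x) ^ (4 * 2) by positivity)
    nlinarith [mul_nonneg h0 (sub_nonneg.2 e0)]
  have e5 : x ^ 3 ≤ 3 / 100 * x ^ 2 := by
    have := mul_le_mul_of_nonneg_right hx2 (sq_nonneg x)
    linarith [show x * x ^ 2 = x ^ 3 by ring]
  rw [symGap, hxx]
  have := mul_nonneg (sq_nonneg vertGap) (sq_nonneg (-x))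
  linarith

/-- Near `w = 1` the linear term costs at most `0.72 * 4 * S = 2.88 * S`, the quadratic one at most
`S / 50`, while `v ^ 2 ≤ 1 - 43 * S` gains `3.87 * S`. -/
theorem symGap_neg {w v S : ℝ} (h0 : 0 < S) (hS : S ≤ 1 / 1000) (h1 : w ≤ 1) (h2 : 1 - 4 * S ≤ w)
    (hv0 : 0 ≤ v) (hv : v ≤ w ^ 4 * Real.exp (-(23 * S))) : symGap w v < 0 := by
  obtain ⟨c1, c2⟩ := vertGap_bounds
  have e1 : v ≤ Real.exp (-(23 * S)) := hv.trans (by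
    have : w ^ 4 ≤ 1 := pow_le_one₀ (by linarith) h1
    nlinarith [Real.exp_pos (-(23 * S))])
  have e2 : v ^ 2 ≤ (Real.exp (46 * S))⁻¹ := by
    refine (pow_le_pow_left₀ hv0 e1 2).trans_eq ?_
    rw [← Real.exp_nat_mul, ← Real.exp_neg]
    push_cast
    ring_nf
  have e3 : v ^ 2 ≤ 1 - 43 * S := by
    refine e2.trans ?_
    rw [inv_le_comm₀ (Real.exp_pos _) (by linarith)]
    refine le_trans ?_ (Real.add_one_le_exp _)
    rw [inv_le_iff_one_le_mul₀ (by linarith)]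
    nlinarith
  have e4 : (w - 1) ^ 2 ≤ S * (1 / 50) := by nlinarith
  have e5 : vertGap ^ 2 ≤ 1 := by nlinarith
  have e6 : vertGap ^ 2 * (w - 1) ^ 2 ≤ 1 * (S * (1 / 50)) :=
    mul_le_mul e5 e4 (sq_nonneg _) zero_le_one
  rw [symGap]
  linarith

/-! ### Euler sequences of the ten agents -/

/-- Only indices below `k` need a nonnegative excess, so the formula also covers the first sample in
contact. -/
theorem eulerSeq_eq_symConf {t : ℕ → ℝ} {k : ℕ} (ht : t 0 = 0)
    (h0 : ∀ j < k, 0 ≤ t (j + 1) - t j) (h1 : ∀ j < k, t (j + 1) - t j ≤ 1 / 700)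
    (hg : ∀ j < k, 0 ≤ symGap (decay 2 t j) (decay 8 t j)) :
    eulerSeq originalField t tenInit k = symConf (decay 2 t k) (decay 8 t k) ∧
    ∀ j < k, originalField (eulerSeq originalField t tenInit j) =
      confField 0 (eulerSeq originalField t tenInit j) := by
  induction k with
  | zero => simp [eulerSeq, tenInit_eq, decay]
  | succ k ih =>
    obtain ⟨ih1, ih2⟩ := ih (fun j hj => h0 j (by omega)) (fun j hj => h1 j (by omega))
      (fun j hj => hg j (by omega))
    have htk : 0 ≤ t k := by
      have := Finset.sum_nonneg fun j (hj : j ∈ Finset.range k) =>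
        h0 j (by have := Finset.mem_range.1 hj; omega)
      rwa [Finset.sum_range_sub, ht, sub_zero] at this
    have s2 : ∀ j < k, 2 * (t (j + 1) - t j) ≤ 1 := fun j hj => by linarith [h1 j (by omega)]
    have s8 : ∀ j < k, 8 * (t (j + 1) - t j) ≤ 1 := fun j hj => by linarith [h1 j (by omega)]
    have hfield : originalField (eulerSeq originalField t tenInit k) =
        confField 0 (eulerSeq originalField t tenInit k) := by
      rw [ih1]
      refine originalField_symConf (decay_nonneg s2) ?_ (decay_nonneg s8) ?_ (hg k (by omega))
      · refine (decay_le ht s2).trans ((Real.exp_le_exp.2 ?_).trans exp_one_div_fifty_lt.le)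
        rw [contactTime_eq]; linarith
      · refine (decay_le ht s8).trans ((Real.exp_le_exp.2 ?_).trans exp_two_twenty_fifths_lt.le)
        rw [contactTime_eq]; linarith
    refine ⟨?_, fun j hj => ?_⟩
    · rw [eulerSeq, hfield, ih1, symConf_euler, decay_succ, decay_succ]
    · rcases Nat.lt_succ_iff_lt_or_eq.1 hj with hj | rfl
      · exact ih2 j hj
      · exact hfield

theorem originalField_eulerSeq_after_contact {t : ℕ → ℝ} {n : ℕ} {w v h : ℝ} (h0 : 0 ≤ h) (h1 : h ≤ 1 / 50)
    (ht : ∀ j, n ≤ j → t (j + 1) - t j = h)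
    (hstart : eulerSeq originalField t tenInit n = symConf w v)
    (hw : 99 / 100 ≤ w) (hw' : w ≤ 101 / 100) (hv : 0 ≤ v) (hv' : v ≤ 6 / 5)
    (hg : symGap w v < 0) (i : ℕ) (hi : i * h ≤ 1 / 50) :
    originalField (eulerSeq originalField t tenInit (n + i)) =
      confField 1 (eulerSeq originalField t tenInit (n + i)) := by
  have hfield : ∀ j : ℕ, j * h ≤ 1 / 50 →
      originalField (modeConf (halfGap * v) ((bary + vertGap * w) / 9) (bary - vertGap * w)
        ((1 - 9 * h) ^ j) ((1 - h) ^ j) ((1 - 10 * h) ^ j)) =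
      confField 1 (modeConf (halfGap * v) ((bary + vertGap * w) / 9) (bary - vertGap * w)
        ((1 - 9 * h) ^ j) ((1 - h) ^ j) ((1 - 10 * h) ^ j)) := by
    intro j hj
    obtain ⟨c1, c2⟩ := contactHeight_bounds
    obtain ⟨b1, b2⟩ := vertGap_bounds
    have m1 : 377 / 1000 * (99 / 100) ≤ vertGap * w := mul_le_mul b1.le hw (by norm_num) (by linarith)
    have m2 : vertGap * w ≤ 378 / 1000 * (101 / 100) :=
      mul_le_mul b2.le hw' (by linarith) (by norm_num)
    have e1 : (1 - h) ^ j ≤ 1 := pow_le_one₀ (by linarith) (by linarith)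
    have e9 : (1 - 9 * h) ^ j ≤ 1 := pow_le_one₀ (by linarith) (by linarith)
    have e10 : (1 - 10 * h) ^ j ≤ 1 := pow_le_one₀ (by linarith) (by linarith)
    have p9 : 0 ≤ (1 - 9 * h) ^ j := pow_nonneg (by linarith) j
    -- Bernoulli keeps the amplitudes above `98 / 100` and `8 / 10` for elapsed times up to `1 /
    -- 50`.
    have l1 := one_add_mul_le_pow (show -2 ≤ -h by linarith) j
    have l10 := one_add_mul_le_pow (show -2 ≤ -(10 * h) by linarith) j
    rw [← sub_eq_add_neg] at l1 l10
    have q9 : (halfGap * v * (1 - 9 * h) ^ j) ^ 2 ≤ (halfGap * v) ^ 2 := by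
      rw [mul_pow _ ((1 - 9 * h) ^ j)]
      exact mul_le_of_le_one_right (sq_nonneg _) (pow_le_one₀ p9 e9)
    rw [bary_eq]
    refine originalField_modeConf (by linarith) (by linarith) (by linarith) (by linarith)
      (by linarith) e1 (by linarith) e10 ?_ ?_
    · rw [halfGap_eq] at *
      have := pow_le_pow_left₀ hv hv' 2
      rw [mul_pow _ v] at q9
      linarith
    · have g := symGap_eq w v
      rw [bary_eq] at g
      have n1 : 0 ≤ (contactHeight + vertGap + vertGap * w) / 9 := by linarith
      have n2 : 0 ≤ contactHeight + vertGap - vertGap * w -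
        (contactHeight + vertGap + vertGap * w) / 9 := by linarith
      have n3 := mul_le_mul_of_nonneg_left e1 n1
      have n4 := mul_le_mul_of_nonneg_left e10 n2
      have n5 := pow_le_pow_left₀ (add_nonneg (mul_nonneg n1 (pow_nonneg (by linarith) j))
        (mul_nonneg n2 (pow_nonneg (by linarith) j))) (add_le_add n3 n4) 2
      have n6 : ((contactHeight + vertGap + vertGap * w) / 9 * 1 +
        (contactHeight + vertGap - vertGap * w -
          (contactHeight + vertGap + vertGap * w) / 9) * 1) ^ 2 =
        (contactHeight + vertGap - vertGap * w - 0) ^ 2 := by ring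
      linarith
  have hseq : ∀ j : ℕ, j * h ≤ 1 / 50 → eulerSeq originalField t tenInit (n + j) =
      modeConf (halfGap * v) ((bary + vertGap * w) / 9) (bary - vertGap * w)
        ((1 - 9 * h) ^ j) ((1 - h) ^ j) ((1 - 10 * h) ^ j) := by
    intro j
    induction j with
    | zero =>
      intro _
      simp only [add_zero, pow_zero]
      rw [hstart, symConf_eq_modeConf]
    | succ j ih =>
      intro hj
      have hj' : j * h ≤ 1 / 50 := by push_cast at hj; linarith
      rw [← add_assoc, eulerSeq, ht _ (by omega), ih hj', hfield j hj', modeConf_euler, pow_succ,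
        pow_succ, pow_succ]
  rw [hseq i hi, hfield i hi]

/-! ### The contact along the two grids -/

section Grids

variable {q : ℕ} {h : ℝ}

/-- Here `q * h = 1 / (100 * q)`; the threshold 28 makes even the long step `4 * (q * h)` at most `1
/ 700`. -/
theorem step_facts (hq : 28 ≤ q) (hh : h = contactTime / (q : ℝ) ^ 2) :
    0 < h ∧ (q : ℝ) ^ 2 * h = 1 / 100 ∧ 0 < q * h ∧ q * h ≤ 1 / 2800 ∧ h ≤ 1 / 700 := by
  have hq' : (28 : ℝ) ≤ q := by exact_mod_cast hq
  have e1 : (q : ℝ) ^ 2 * h = 1 / 100 := by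
    rw [hh, contactTime_eq]
    field_simp
  have e0 : 0 < h := by
    rw [hh, contactTime_eq]
    positivity
  have e2 : q * h ≤ 1 / 2800 := by nlinarith
  exact ⟨e0, e1, by positivity, e2, by nlinarith⟩

theorem sqStep_of_uniform {t : ℕ → ℝ} {k : ℕ} (ht : ∀ j ≤ k, t j = j * h) :
    sqStep t k = k * h ^ 2 := by
  have : ∀ j ∈ Finset.range k, (t (j + 1) - t j) ^ 2 = h ^ 2 := fun j hj => by
    have := Finset.mem_range.1 hj
    rw [ht _ (by omega), ht _ (by omega)]
    push_cast
    ring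
  rw [sqStep, Finset.sum_congr rfl this]
  simp

theorem sub_of_uniform {t : ℕ → ℝ} {k : ℕ} (ht : ∀ j ≤ k, t j = j * h) {j : ℕ} (hj : j < k) :
    t (j + 1) - t j = h := by
  rw [ht _ (by omega), ht _ (by omega)]
  push_cast
  ring

/-- At least `q` steps before the contact time, `w - 1` is at least `1.9 * (q * h)`, whose square
`3.61 * (q * h) ^ 2` beats `18 / 5 * S` because `S ≤ (q * h) ^ 2`. -/
theorem symGap_before_contact (hq : 28 ≤ q) (hh : h = contactTime / (q : ℝ) ^ 2) {t : ℕ → ℝ}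
    {k : ℕ} (hk : k ≤ q ^ 2 - q) (ht : ∀ j ≤ k, t j = j * h) :
    0 ≤ symGap (decay 2 t k) (decay 8 t k) := by
  obtain ⟨p0, p1, p2, p3, p4⟩ := step_facts hq hh
  have hd : ∀ j < k, t (j + 1) - t j = h := fun j hj => sub_of_uniform ht hj
  have hkq : (k : ℝ) + q ≤ (q : ℝ) ^ 2 := by
    have : k + q ≤ q ^ 2 := by have := Nat.le_self_pow two_ne_zero q; omega
    exact_mod_cast this
  have ht0 : t 0 = 0 := by simp [ht 0 (Nat.zero_le k)]
  have hkh : k * h + q * h ≤ 1 / 100 := by rw [← add_mul, ← p1]; gcongr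
  have hk0 : 0 ≤ k * h := by positivity
  have hS : sqStep t k ≤ (q * h) ^ 2 := by
    rw [sqStep_of_uniform ht, mul_pow]
    have := mul_le_mul_of_nonneg_right (show (k : ℝ) ≤ (q : ℝ) ^ 2 by linarith [q.cast_nonneg (α := ℝ)])
      (sq_nonneg h)
    exact this
  have hS0 : 0 ≤ sqStep t k := Finset.sum_nonneg fun _ _ => sq_nonneg _
  have g0 : ∀ j < k, 0 ≤ t (j + 1) - t j := fun j hj => by rw [hd j hj]; exact p0.le
  have g1 : ∀ j < k, t (j + 1) - t j ≤ 1 / 700 := fun j hj => by rw [hd j hj]; exact p4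
  have hlow := le_decay_two ht0 g0 g1
  have hup := decay_le (k := 2) (n := k) ht0 fun j hj => by linarith [g1 j hj]
  have htk := ht k le_rfl
  have hw : 1 + 19 / 10 * (q * h) ≤ decay 2 t k := by
    refine le_trans ?_ hlow
    have e1 : 1 + 2 * (q * h) ≤ Real.exp (2 * contactTime - 2 * t k) := by
      refine le_trans ?_ (Real.add_one_le_exp _)
      rw [htk, contactTime_eq]
      linarith
    have e2 : 1 - 4 * (q * h) ^ 2 ≤ 1 - 4 * sqStep t k := by linarith
    refine le_trans ?_ (mul_le_mul e1 e2 (by nlinarith) (Real.exp_pos _).le)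
    nlinarith
  refine symGap_nonneg_of_one_le hS0 (by linarith) ?_ ?_ (le_decay_eight g0 g1)
  · refine hup.trans ((Real.exp_le_exp.2 ?_).trans exp_one_div_fifty_lt.le)
    rw [htk, contactTime_eq]
    linarith
  · have := pow_le_pow_left₀ (by positivity) (show 19 / 10 * (q * h) ≤ decay 2 t k - 1 by linarith) 2
    nlinarith

theorem symGap_at_contact (hq : 28 ≤ q) (hh : h = contactTime / (q : ℝ) ^ 2) {t : ℕ → ℝ}
    (ht : ∀ j ≤ q ^ 2, t j = j * h) :
    symGap (decay 2 t (q ^ 2)) (decay 8 t (q ^ 2)) < 0 := by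
  obtain ⟨p0, p1, p2, p3, p4⟩ := step_facts hq hh
  have hd : ∀ j < q ^ 2, t (j + 1) - t j = h := fun j hj => sub_of_uniform ht hj
  have ht0 : t 0 = 0 := by simp [ht 0 (Nat.zero_le _)]
  have g0 : ∀ j < q ^ 2, 0 ≤ t (j + 1) - t j := fun j hj => by rw [hd j hj]; exact p0.le
  have g1 : ∀ j < q ^ 2, t (j + 1) - t j ≤ 1 / 700 := fun j hj => by rw [hd j hj]; exact p4
  have hlow := le_decay_two ht0 g0 g1
  have hup := decay_le (k := 2) ht0 fun j hj => by linarith [g1 j hj]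
  have hT : 2 * contactTime - 2 * t (q ^ 2) = 0 := by
    rw [ht _ le_rfl, Nat.cast_pow, p1, contactTime_eq]
    ring
  rw [hT, Real.exp_zero] at hlow hup
  have hS : sqStep t (q ^ 2) = (q * h) ^ 2 := by
    rw [sqStep_of_uniform ht]
    push_cast
    ring
  refine symGap_neg (S := sqStep t (q ^ 2)) ?_ ?_ hup (by linarith)
    (decay_nonneg fun j hj => by linarith [g1 j hj]) (decay_eight_le g0 g1)
  · rw [hS]; positivity
  · rw [hS]; nlinarith

theorem jumpGrid_of_le {j : ℕ} (hj : j ≤ q ^ 2 - q) : jumpGrid h q j = j * h := if_pos hj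

theorem jumpGrid_of_lt {j : ℕ} (hj : q ^ 2 - q < j) : jumpGrid h q j = (j + 4 * q - 1) * h :=
  if_neg (not_le.2 hj)

theorem jumpGrid_sub_of_ne {j : ℕ} (hj : j ≠ q ^ 2 - q) :
    jumpGrid h q (j + 1) - jumpGrid h q j = h := by
  rcases lt_or_gt_of_ne hj with hj | hj
  · rw [jumpGrid_of_le (by omega), jumpGrid_of_le (by omega)]
    push_cast
    ring
  · rw [jumpGrid_of_lt (by omega), jumpGrid_of_lt (by omega)]
    push_cast
    ring

theorem jumpGrid_sub_of_eq :
    jumpGrid h q (q ^ 2 - q + 1) - jumpGrid h q (q ^ 2 - q) = 4 * (q * h) := by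
  rw [jumpGrid_of_lt (by omega), jumpGrid_of_le le_rfl]
  push_cast
  ring

theorem jumpGrid_sub_mem (hq : 1 ≤ q) (h0 : 0 < h) (j : ℕ) :
    0 < jumpGrid h q (j + 1) - jumpGrid h q j ∧
    jumpGrid h q (j + 1) - jumpGrid h q j ≤ 4 * (q * h) := by
  have hq' : (1 : ℝ) ≤ q := by exact_mod_cast hq
  have := mul_le_mul_of_nonneg_right hq' h0.le
  by_cases hj : j = q ^ 2 - q
  · rw [hj, jumpGrid_sub_of_eq]
    exact ⟨by linarith, le_rfl⟩
  · rw [jumpGrid_sub_of_ne hj]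
    exact ⟨h0, by linarith⟩

theorem sqStep_jumpGrid (i : ℕ) : sqStep (jumpGrid h q) (q ^ 2 - q + 1 + i) =
    ((q ^ 2 - q + i : ℕ) : ℝ) * h ^ 2 + 16 * (q * h) ^ 2 := by
  induction i with
  | zero =>
    have := sqStep_of_uniform (t := jumpGrid h q) (h := h) (k := q ^ 2 - q)
      fun j hj => jumpGrid_of_le hj
    rw [sqStep] at this ⊢
    rw [add_zero, add_zero, Finset.sum_range_succ, this, jumpGrid_sub_of_eq]
    ring
  | succ i ih =>
    rw [← add_assoc, sqStep, Finset.sum_range_succ, ← sqStep, ih, jumpGrid_sub_of_ne (by omega)]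
    push_cast
    ring

theorem symGap_jumpGrid (hq : 28 ≤ q) (hh : h = contactTime / (q : ℝ) ^ 2) {k : ℕ}
    (hk : jumpGrid h q k ≤ 2 * contactTime) :
    0 ≤ symGap (decay 2 (jumpGrid h q) k) (decay 8 (jumpGrid h q) k) := by
  obtain ⟨p0, p1, p2, p3, p4⟩ := step_facts hq hh
  rcases le_or_gt k (q ^ 2 - q) with hkn | hkn
  · exact symGap_before_contact hq hh hkn fun j hj => jumpGrid_of_le (hj.trans hkn)
  have ht0 : jumpGrid h q 0 = 0 := by simp [jumpGrid]
  have g0 : ∀ j < k, 0 ≤ jumpGrid h q (j + 1) - jumpGrid h q j := fun j _ =>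
    (jumpGrid_sub_mem (by omega) p0 j).1.le
  have g1 : ∀ j < k, jumpGrid h q (j + 1) - jumpGrid h q j ≤ 1 / 700 := fun j _ =>
    (jumpGrid_sub_mem (by omega) p0 j).2.trans (by linarith)
  have hlow := le_decay_two ht0 g0 g1
  have hup := decay_le (k := 2) (n := k) ht0 fun j hj => by linarith [g1 j hj]
  have hq2 : q ≤ q ^ 2 := Nat.le_self_pow two_ne_zero q
  have htk := jumpGrid_of_lt (h := h) hkn
  have hk' : (q : ℝ) ^ 2 + 1 ≤ k + q := by
    have : q ^ 2 + 1 ≤ k + q := by omega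
    exact_mod_cast this
  have hq' : (28 : ℝ) ≤ q := by exact_mod_cast hq
  -- The long step goes from `q * h` before the contact time to `3 * (q * h)` after it.
  have htlow : 1 / 100 + 3 * (q * h) ≤ jumpGrid h q k := by
    rw [htk, ← p1]
    nlinarith [mul_le_mul_of_nonneg_right hk' p0.le]
  rw [contactTime_eq] at hk hup hlow
  have hkh : k * h ≤ 1 / 50 := by
    rw [htk] at hk
    nlinarith
  -- The long step contributes 16 and the short ones at most 2. The requirement `19 / 10 * 18 =
  -- 34.2` stays below `5.9 ^ 2 = 34.81`, the square of the bound on `1 - w`.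
  have hS : sqStep (jumpGrid h q) k ≤ 18 * (q * h) ^ 2 := by
    obtain ⟨i, rfl⟩ := Nat.exists_eq_add_of_le (show q ^ 2 - q + 1 ≤ k by omega)
    rw [sqStep_jumpGrid]
    have e1 : ((q ^ 2 - q + i : ℕ) : ℝ) * h ≤ 2 * ((q : ℝ) ^ 2 * h) := by
      rw [p1]
      push_cast at hkh ⊢
      linarith
    have := mul_le_mul_of_nonneg_right e1 p0.le
    linarith
  have hS0 : 0 ≤ sqStep (jumpGrid h q) k := Finset.sum_nonneg fun _ _ => sq_nonneg _
  have hw : decay 2 (jumpGrid h q) k ≤ 1 - 59 / 10 * (q * h) := by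
    refine hup.trans ((Real.exp_le_exp.2 (show _ ≤ -(6 * (q * h)) by linarith)).trans ?_)
    have := Real.add_one_le_exp (6 * (q * h))
    rw [Real.exp_neg, inv_le_iff_one_le_mul₀ (Real.exp_pos _)]
    nlinarith [mul_le_mul_of_nonneg_left this (show 0 ≤ 1 - 59 / 10 * (q * h) by linarith)]
  have hw2 : 97 / 100 ≤ decay 2 (jumpGrid h q) k := by
    refine le_trans ?_ hlow
    have e1 : 98 / 100 ≤ Real.exp (2 * (1 / 100) - 2 * jumpGrid h q k) := by
      refine le_trans ?_ (Real.add_one_le_exp _)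
      linarith
    have e2 : 99 / 100 ≤ 1 - 4 * sqStep (jumpGrid h q) k := by nlinarith
    exact le_trans (by norm_num) (mul_le_mul e1 e2 (by norm_num) (Real.exp_pos _).le)
  refine symGap_nonneg_of_le_one hS0 (by linarith) hw2 ?_ (le_decay_eight g0 g1)
  have := pow_le_pow_left₀ (by positivity)
    (show 59 / 10 * (q * h) ≤ 1 - decay 2 (jumpGrid h q) k by linarith) 2
  nlinarith

end Grids

/-! ### Regularity of trajectories that switch between two linear fields -/

/-- The trajectory is bounded on the compact interval, hence so are its velocities. This gives
absolute continuity and the speed bound at the switch. -/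
theorem exists_lipschitz_of_switch {E : Type*} [NormedAddCommGroup E] [NormedSpace ℝ E]
    {L₁ L₂ : E →L[ℝ] E} {y : ℝ → E} {T τ : ℝ} (hyc : ContinuousOn y (Icc 0 T))
    (hy₁ : ∀ s ∈ Ico 0 τ, HasDerivWithinAt y (L₁ (y s)) (Ici s) s)
    (hy₂ : ∀ s ∈ Ico τ T, HasDerivWithinAt y (L₂ (y s)) (Ici s) s) :
    ∃ C, 0 ≤ C ∧ ∀ s s', 0 ≤ s → s ≤ s' → s' ≤ T → ‖y s' - y s‖ ≤ C * (s' - s) := by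
  obtain ⟨R, hR⟩ := isCompact_Icc.exists_bound_of_continuousOn hyc
  set M := max ‖L₁‖ ‖L₂‖ * max R 0 with hM
  refine ⟨M, by positivity, fun s s' hs hss hs' => ?_⟩
  have hex : ∀ u : ℝ, ∃ d : E, u ∈ Ico s s' → HasDerivWithinAt y d (Ici u) u ∧ ‖d‖ ≤ M := by
    intro u
    by_cases hu : u ∈ Ico s s'
    · have hRu := (hR u ⟨hs.trans hu.1, hu.2.le.trans hs'⟩).trans (le_max_left R 0)
      rcases lt_or_ge u τ with h | h
      · exact ⟨_, fun _ => ⟨hy₁ u ⟨hs.trans hu.1, h⟩, (L₁.le_opNorm _).trans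
          (mul_le_mul (le_max_left _ _) hRu (norm_nonneg _) (by positivity))⟩⟩
      · exact ⟨_, fun _ => ⟨hy₂ u ⟨h, hu.2.trans_le hs'⟩, (L₂.le_opNorm _).trans
          (mul_le_mul (le_max_right _ _) hRu (norm_nonneg _) (by positivity))⟩⟩
    · exact ⟨0, fun hu' => absurd hu' hu⟩
  choose d hd using hex
  exact norm_image_sub_le_of_norm_deriv_right_le_segment (hyc.mono (Icc_subset_Icc hs hs'))
    (fun u hu => (hd u hu).1) (fun u hu => (hd u hu).2) s' ⟨hss, le_rfl⟩

theorem absolutelyContinuousOnInterval_of_norm_sub_le {E : Type*} [NormedAddCommGroup E]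
    {y : ℝ → E} {T C : ℝ} (hT : 0 ≤ T) (hC : 0 ≤ C)
    (h : ∀ s s', 0 ≤ s → s ≤ s' → s' ≤ T → ‖y s' - y s‖ ≤ C * (s' - s)) :
    AbsolutelyContinuousOnInterval y 0 T := by
  refine LipschitzOnWith.absolutelyContinuousOnInterval (K := ⟨C, hC⟩) ?_
  rw [uIcc_of_le hT]
  refine LipschitzOnWith.of_dist_le_mul fun s hs s' hs' => ?_
  rcases le_total s s' with hss | hss
  · rw [dist_comm, dist_eq_norm, dist_comm s, Real.dist_eq, abs_of_nonneg (sub_nonneg.2 hss)]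
    exact h s s' hs.1 hss hs'.2
  · rw [dist_eq_norm, Real.dist_eq, abs_of_nonneg (sub_nonneg.2 hss)]
    exact h s' s hs'.1 hss hs.2

/-! ### The two trajectories of the ten agents -/

theorem continuous_trajX : Continuous trajX :=
  continuous_iff_continuousAt.2 fun t => (hasDerivAt_trajX t).continuousAt

theorem isClassical_trajX (S : ℝ) : IsClassical originalField S trajX := fun t ht => by
  rw [originalField_trajX ht.1]
  exact (hasDerivAt_trajX t).hasDerivWithinAt

theorem exists_lipschitz_trajX (S : ℝ) :
    ∃ C, 0 ≤ C ∧ ∀ s s', 0 ≤ s → s ≤ s' → s' ≤ S → ‖trajX s' - trajX s‖ ≤ C * (s' - s) :=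
  exists_lipschitz_of_switch (τ := S) (L₂ := confField 0) continuous_trajX.continuousOn
    (fun s _ => (hasDerivAt_trajX s).hasDerivWithinAt)
    (fun s _ => (hasDerivAt_trajX s).hasDerivWithinAt)

theorem isCaratheodory_trajX {S : ℝ} (hS : 0 < S) : IsCaratheodory originalField S trajX := by
  obtain ⟨C, hC, h⟩ := exists_lipschitz_trajX S
  refine ⟨absolutelyContinuousOnInterval_of_norm_sub_le hS.le hC h,
    Eventually.of_forall fun t ht => ?_⟩
  rw [originalField_trajX ht.1]
  exact hasDerivAt_trajX t

theorem hasDerivAt_trajY_of_lt {t : ℝ} (ht : t < contactTime) :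
    HasDerivAt (trajY flowY) (confField 0 (trajY flowY t)) t := by
  rw [trajY_of_le ht.le]
  refine (hasDerivAt_trajX t).congr_of_eventuallyEq ?_
  filter_upwards [eventually_lt_nhds ht] with s hs using trajY_of_le hs.le

theorem hasDerivAt_flowConf_sub (t : ℝ) : HasDerivAt (fun s => flowConf (s - contactTime))
    (confField 1 (flowConf (t - contactTime))) t :=
  (hasDerivAt_flowConf (t - contactTime)).comp_sub_const t contactTime

theorem hasDerivAt_trajY_of_gt {t : ℝ} (ht : contactTime < t) :
    HasDerivAt (trajY flowY) (confField 1 (trajY flowY t)) t := by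
  rw [trajY_of_ge ht.le]
  refine (hasDerivAt_flowConf_sub t).congr_of_eventuallyEq ?_
  filter_upwards [eventually_gt_nhds ht] with s hs using trajY_of_ge hs.le

theorem hasDerivWithinAt_trajY_of_ge {t : ℝ} (ht : contactTime ≤ t) :
    HasDerivWithinAt (trajY flowY) (confField 1 (trajY flowY t)) (Ici t) t := by
  rw [trajY_of_ge ht]
  exact (hasDerivAt_flowConf_sub t).hasDerivWithinAt.congr
    (fun s hs => trajY_of_ge (ht.trans hs)) (trajY_of_ge ht)

theorem continuous_trajY : Continuous (trajY flowY) := by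
  have : trajY flowY = fun t => if t ≤ contactTime then trajX t else flowConf (t - contactTime) := by
    funext t
    split_ifs with h
    · exact trajY_of_le h
    · exact trajY_of_ge (not_le.1 h).le
  rw [this]
  refine Continuous.if_le continuous_trajX ?_ continuous_id continuous_const ?_
  · exact continuous_iff_continuousAt.2 fun t => (hasDerivAt_flowConf_sub t).continuousAt
  · rintro t rfl
    rw [sub_self, flowConf_zero]

theorem exists_lipschitz_trajY (S : ℝ) : ∃ C, 0 ≤ C ∧
    ∀ s s', 0 ≤ s → s ≤ s' → s' ≤ S → ‖trajY flowY s' - trajY flowY s‖ ≤ C * (s' - s) :=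
  exists_lipschitz_of_switch (τ := contactTime) continuous_trajY.continuousOn
    (fun _ hs => (hasDerivAt_trajY_of_lt hs.2).hasDerivWithinAt)
    (fun _ hs => hasDerivWithinAt_trajY_of_ge hs.1)

theorem originalField_trajY_of_lt {t : ℝ} (ht0 : 0 ≤ t) (ht : t < contactTime) :
    originalField (trajY flowY t) = confField 0 (trajY flowY t) := by
  rw [trajY_of_le ht.le, originalField_trajX ht0]

theorem originalField_trajY_of_gt {t : ℝ} (ht : contactTime < t) (ht' : t ≤ 2 * contactTime) :
    originalField (trajY flowY t) = confField 1 (trajY flowY t) := by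
  rw [trajY_of_ge ht.le]
  rw [contactTime_eq] at *
  exact originalField_flowConf (by linarith) (by linarith)

theorem isCaratheodory_trajY {S : ℝ} (hS : 0 ≤ S) (hS' : S ≤ 2 * contactTime) :
    IsCaratheodory originalField S (trajY flowY) := by
  obtain ⟨C, hC, h⟩ := exists_lipschitz_trajY S
  refine ⟨absolutelyContinuousOnInterval_of_norm_sub_le hS hC h, ?_⟩
  -- The field changes at the contact time, a null set that the almost-everywhere condition ignores.
  have hne : ∀ᵐ t : ℝ, t ≠ contactTime := by
    simp [MeasureTheory.ae_iff]
  filter_upwards [hne] with t htne ht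
  rcases lt_or_gt_of_ne htne with hlt | hgt
  · rw [originalField_trajY_of_lt ht.1 hlt]
    exact hasDerivAt_trajY_of_lt hlt
  · rw [originalField_trajY_of_gt hgt (ht.2.trans hS')]
    exact hasDerivAt_trajY_of_gt hgt

/-- Agent 3 stays on the horizontal axis along `trajX`, whereas agent 1 lifts it along `trajY`. -/
theorem trajX_ne_trajY {t : ℝ} (ht : contactTime < t) : trajX t ≠ trajY flowY t := by
  intro h
  have h := congrArg (fun x : Fin 10 → Plane => x 2 1) h
  obtain ⟨c1, c2⟩ := contactHeight_bounds
  obtain ⟨b1, b2⟩ := vertGap_bounds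
  have e1 : Real.exp (-1 * (t - contactTime)) < 1 := Real.exp_lt_one_iff.2 (by linarith)
  have e10 : Real.exp (-10 * (t - contactTime)) < 1 := Real.exp_lt_one_iff.2 (by linarith)
  simp only [trajX_eq, symConf, trajY_of_ge ht.le, flowConf, modeConf, conf_apply_two, bary_eq] at h
  simp only [Matrix.cons_val_one, Matrix.cons_val_fin_one] at h
  have m1 := mul_pos (show 0 < (contactHeight + vertGap + vertGap) / 9 by linarith) (sub_pos.2 e1)
  have m2 := mul_pos (show 0 < (contactHeight - (contactHeight + vertGap + vertGap) / 9) / 10 by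
    linarith) (sub_pos.2 e10)
  linarith

/-! ### The sampling grids up to the horizon -/

theorem horizon_bounds {r : ℕ} (hr : 1 ≤ r) :
    contactTime < horizon r ∧ horizon r ≤ 2 * contactTime := by
  have hr' : (1 : ℝ) ≤ r := by exact_mod_cast hr
  have e : horizon r = contactTime + contactTime / r := by
    unfold horizon
    field_simp
  rw [e, contactTime_eq]
  have h1 : 0 < (1 / 100 : ℝ) / r := by positivity
  have h2 : (1 / 100 : ℝ) / r ≤ 1 / 100 := div_le_self (by norm_num) hr'
  constructor <;> linarith

theorem isPartition_uniformGrid {r s : ℕ} (hr : 1 ≤ r) (hs : 1 ≤ s) :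
    IsPartition (horizon r) ((r + 1) * r * s ^ 2)
      (uniformGrid (contactTime / ((r * s : ℕ) : ℝ) ^ 2)) where
  start_eq := by simp [uniformGrid]
  end_eq := by
    have hr' : (r : ℝ) ≠ 0 := by positivity
    have hs' : (s : ℝ) ≠ 0 := by positivity
    unfold uniformGrid horizon
    push_cast
    field_simp
  lt_succ j _ := by
    have hr' : (0 : ℝ) < r := by positivity
    have hs' : (0 : ℝ) < s := by positivity
    have : 0 < contactTime / ((r * s : ℕ) : ℝ) ^ 2 := by
      rw [contactTime_eq]
      push_cast
      positivity
    unfold uniformGrid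
    push_cast at *
    linarith

/-- One long step replaces `4 * q` uniform ones. The condition `3 ≤ s` ensures that the natural
subtraction is not truncated and that the long step ends no later than the horizon. -/
theorem jumpGrid_card (r : ℕ) {s : ℕ} (hs : 3 ≤ s) :
    ((r + 1) * r * s ^ 2 - 4 * (r * s) + 1) + 4 * (r * s) = (r + 1) * r * s ^ 2 + 1 ∧
    (r * s) ^ 2 - r * s < (r + 1) * r * s ^ 2 - 4 * (r * s) + 1 := by
  have h1 : (r + 1) * r * s ^ 2 = (r * s) ^ 2 + (r * s) * s := by ring
  have h2 : (r * s) * 3 ≤ (r * s) * s := Nat.mul_le_mul_left _ hs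
  have h3 : r * s ≤ (r * s) ^ 2 := Nat.le_self_pow two_ne_zero _
  rw [h1]
  generalize r * s = q at *
  generalize q * s = u at *
  generalize q ^ 2 = w at *
  omega

theorem isPartition_jumpGrid {r s : ℕ} (hr : 1 ≤ r) (hs : 3 ≤ s) :
    IsPartition (horizon r) ((r + 1) * r * s ^ 2 - 4 * (r * s) + 1)
      (jumpGrid (contactTime / ((r * s : ℕ) : ℝ) ^ 2) (r * s)) where
  start_eq := by simp [jumpGrid]
  end_eq := by
    obtain ⟨h1, h2⟩ := jumpGrid_card r hs
    have hr' : (r : ℝ) ≠ 0 := by positivity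
    have hs' : (s : ℝ) ≠ 0 := by positivity
    have h3 : (((r + 1) * r * s ^ 2 - 4 * (r * s) + 1 : ℕ) : ℝ) + 4 * ((r * s : ℕ) : ℝ) - 1 =
        (r + 1) * r * s ^ 2 := by
      have : ((((r + 1) * r * s ^ 2 - 4 * (r * s) + 1) + 4 * (r * s) : ℕ) : ℝ) =
        (((r + 1) * r * s ^ 2 + 1 : ℕ) : ℝ) := by rw [h1]
      rw [Nat.cast_add, Nat.cast_mul 4] at this
      push_cast at this ⊢
      linarith
    rw [jumpGrid_of_lt h2, h3]
    unfold horizon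
    push_cast
    field_simp
  lt_succ j _ := by
    have hr' : (0 : ℝ) < r := by positivity
    have hs' : (0 : ℝ) < s := by positivity
    have : 0 < contactTime / ((r * s : ℕ) : ℝ) ^ 2 := by
      rw [contactTime_eq]
      push_cast
      positivity
    exact sub_pos.1 (jumpGrid_sub_mem (Nat.mul_pos hr (by omega)) this j).1

theorem uniformGrid_sub (h : ℝ) (j : ℕ) : uniformGrid h (j + 1) - uniformGrid h j = h := by
  unfold uniformGrid
  push_cast
  ring

theorem tendsto_mesh {r : ℕ} (hr : 1 ≤ r) : Tendsto (fun σ : ℕ =>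
    4 * (((r * (σ + 3) : ℕ) : ℝ) * (contactTime / ((r * (σ + 3) : ℕ) : ℝ) ^ 2))) atTop (𝓝 0) := by
  have hq : Tendsto (fun σ : ℕ => r * (σ + 3)) atTop atTop :=
    tendsto_atTop_mono (fun σ => by simp only [id]; nlinarith) tendsto_id
  have h1 := (tendsto_const_div_atTop_nhds_zero_nat (4 * contactTime)).comp hq
  refine h1.congr fun σ => ?_
  have hr' : (r : ℝ) ≠ 0 := by positivity
  simp only [Function.comp]
  push_cast
  field_simp

theorem le_of_horizon {r : ℕ} (hr : 1 ≤ r) {σ : ℕ} (hσ : 25 ≤ σ) : 28 ≤ r * (σ + 3) :=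
  (show 28 ≤ 1 * (σ + 3) by omega).trans (Nat.mul_le_mul_right _ hr)

/-- The Euler polygons on the grid with one long step converge to `trajX`. -/
theorem tendstoUniformlyOn_jumpGrid {r : ℕ} (hr : 1 ≤ r) :
    (∀ ε > 0, ∀ᶠ σ : ℕ in atTop, ∀ j < (r + 1) * r * (σ + 3) ^ 2 - 4 * (r * (σ + 3)) + 1,
      jumpGrid (contactTime / ((r * (σ + 3) : ℕ) : ℝ) ^ 2) (r * (σ + 3)) (j + 1) -
        jumpGrid (contactTime / ((r * (σ + 3) : ℕ) : ℝ) ^ 2) (r * (σ + 3)) j < ε) ∧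
    TendstoUniformlyOn (fun σ => eulerCurve originalField
      (jumpGrid (contactTime / ((r * (σ + 3) : ℕ) : ℝ) ^ 2) (r * (σ + 3)))
      ((r + 1) * r * (σ + 3) ^ 2 - 4 * (r * (σ + 3)) + 1) tenInit) trajX atTop
      (Icc 0 (horizon r)) := by
  have hpart := fun σ : ℕ => isPartition_jumpGrid (s := σ + 3) hr (by omega)
  have hT0 : 0 ≤ horizon r := by
    have := (horizon_bounds hr).1
    rw [contactTime_eq] at this
    linarith
  have hmesh : ∀ ε > 0, ∀ᶠ σ : ℕ in atTop,
      ∀ j < (r + 1) * r * (σ + 3) ^ 2 - 4 * (r * (σ + 3)) + 1,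
      jumpGrid (contactTime / ((r * (σ + 3) : ℕ) : ℝ) ^ 2) (r * (σ + 3)) (j + 1) -
        jumpGrid (contactTime / ((r * (σ + 3) : ℕ) : ℝ) ^ 2) (r * (σ + 3)) j < ε := by
    intro ε hε
    filter_upwards [(tendsto_mesh hr).eventually_lt_const hε, eventually_ge_atTop 25]
      with σ hσ hσ25 j _
    have hq := le_of_horizon hr hσ25
    exact (jumpGrid_sub_mem (by omega) (step_facts hq rfl).1 j).2.trans_lt hσ
  refine ⟨hmesh, ?_⟩
  obtain ⟨C, _, hC⟩ := exists_lipschitz_trajX (horizon r)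
  refine tendstoUniformlyOn_of_exact hT0
    (fun σ => isSampleAndHold_eulerCurve originalField tenInit (hpart σ))
    (C := max C (10 : ℕ)) (fun z => (norm_originalField_le z).trans (le_max_right _ _)) hmesh
    (confField 0).lipschitz (fun σ => (eulerCurve_zero _ _ (hpart σ)).trans trajX_zero.symm)
    (fun s s' hs hss hs' => (hC s s' hs hss hs').trans
      (mul_le_mul_of_nonneg_right (le_max_left _ _) (sub_nonneg.2 hss)))
    continuous_trajX.continuousOn (fun s _ => (hasDerivAt_trajX s).hasDerivWithinAt) ?_
  filter_upwards [eventually_ge_atTop 25] with σ hσ j hj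
  have hq := le_of_horizon hr hσ
  obtain ⟨p0, -, -, p3, -⟩ := step_facts hq rfl
  have hd := jumpGrid_sub_mem (q := r * (σ + 3)) (by omega) p0
  rw [eulerCurve_grid _ _ (hpart σ) hj.le]
  refine (eulerSeq_eq_symConf (hpart σ).start_eq (fun j _ => (hd j).1.le)
    (fun j _ => (hd j).2.trans (by linarith)) fun i hi => ?_).2 j hj
  exact symGap_jumpGrid hq rfl (((hpart σ).mem_Icc hi.le).2.trans (horizon_bounds hr).2)

/-- The Euler polygons on the uniform grids converge to `trajY flowY`. -/
theorem tendstoUniformlyOn_uniformGrid {r : ℕ} (hr : 1 ≤ r) :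
    (∀ ε > 0, ∀ᶠ σ : ℕ in atTop, ∀ j < (r + 1) * r * (σ + 3) ^ 2,
      uniformGrid (contactTime / ((r * (σ + 3) : ℕ) : ℝ) ^ 2) (j + 1) -
        uniformGrid (contactTime / ((r * (σ + 3) : ℕ) : ℝ) ^ 2) j < ε) ∧
    TendstoUniformlyOn (fun σ => eulerCurve originalField
      (uniformGrid (contactTime / ((r * (σ + 3) : ℕ) : ℝ) ^ 2))
      ((r + 1) * r * (σ + 3) ^ 2) tenInit) (trajY flowY) atTop (Icc 0 (horizon r)) := by
  have hpart := fun σ : ℕ => isPartition_uniformGrid (s := σ + 3) hr (by omega)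
  have hτ := horizon_bounds hr
  have hT0 : 0 < contactTime := by rw [contactTime_eq]; norm_num
  have hmesh : ∀ ε > 0, ∀ᶠ σ : ℕ in atTop, ∀ j < (r + 1) * r * (σ + 3) ^ 2,
      uniformGrid (contactTime / ((r * (σ + 3) : ℕ) : ℝ) ^ 2) (j + 1) -
        uniformGrid (contactTime / ((r * (σ + 3) : ℕ) : ℝ) ^ 2) j < ε := by
    intro ε hε
    filter_upwards [(tendsto_mesh hr).eventually_lt_const hε, eventually_ge_atTop 25]
      with σ hσ hσ25 j _
    have hq := le_of_horizon hr hσ25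
    have := jumpGrid_sub_mem (q := r * (σ + 3)) (by omega) (step_facts hq rfl).1
      ((r * (σ + 3)) ^ 2 - r * (σ + 3) + 1)
    rw [jumpGrid_sub_of_ne (by omega)] at this
    rw [uniformGrid_sub]
    exact this.2.trans_lt hσ
  refine ⟨hmesh, ?_⟩
  obtain ⟨C, _, hC⟩ := exists_lipschitz_trajY (horizon r)
  refine tendstoUniformlyOn_of_switch (τ := contactTime)
    (fun σ => isSampleAndHold_eulerCurve originalField tenInit (hpart σ))
    (C := max C (10 : ℕ)) (fun z => (norm_originalField_le z).trans (le_max_right _ _)) hmesh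
    ((confField 0).lipschitz.weaken (le_max_left _ _))
    ((confField 1).lipschitz.weaken (le_max_right _ _)) ⟨hT0.le, hτ.1.le⟩
    (fun σ => (eulerCurve_zero _ _ (hpart σ)).trans
      (trajX_zero.symm.trans (trajY_of_le hT0.le).symm))
    (fun s s' hs hss hs' => (hC s s' hs hss hs').trans
      (mul_le_mul_of_nonneg_right (le_max_left _ _) (sub_nonneg.2 hss)))
    continuous_trajY.continuousOn
    (fun s hs => (hasDerivAt_trajY_of_lt hs.2).hasDerivWithinAt)
    (fun s hs => hasDerivWithinAt_trajY_of_ge hs.1) fun ε hε => ?_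
  filter_upwards [(tendsto_mesh hr).eventually_lt_const hε, eventually_ge_atTop 25] with σ hσε hσ
  have hq := le_of_horizon hr hσ
  have hm : (r + 1) * r * (σ + 3) ^ 2 = (r * (σ + 3)) ^ 2 + r * (σ + 3) ^ 2 := by ring
  have hm2 : r * (σ + 3) ^ 2 ≤ (r * (σ + 3)) ^ 2 := by
    rw [mul_pow]
    exact Nat.mul_le_mul_right _ (Nat.le_self_pow two_ne_zero r)
  set m := (r + 1) * r * (σ + 3) ^ 2
  have hp := hpart σ
  set q := r * (σ + 3)
  obtain ⟨p0, p1, p2, p3, p4⟩ := step_facts hq rfl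
  set h := contactTime / (q : ℝ) ^ 2 with hh
  set t := uniformGrid h with ht
  have hd : ∀ j, t (j + 1) - t j = h := uniformGrid_sub h
  have hcontact : symGap (decay 2 t (q ^ 2)) (decay 8 t (q ^ 2)) < 0 :=
    symGap_at_contact hq hh fun j _ => rfl
  classical
  have hex : ∃ k, symGap (decay 2 t k) (decay 8 t k) < 0 := ⟨_, hcontact⟩
  -- The switch is made at the first sample in contact. It lies among the last `q` steps up to the
  -- contact time, so its distance to that time tends to `0`.
  obtain ⟨k, hk, hkmin⟩ : ∃ k, symGap (decay 2 t k) (decay 8 t k) < 0 ∧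
      ∀ j < k, 0 ≤ symGap (decay 2 t j) (decay 8 t j) :=
    ⟨Nat.find hex, Nat.find_spec hex, fun j hj => not_lt.1 (Nat.find_min hex hj)⟩
  have hkq : k ≤ q ^ 2 := by
    by_contra hlt
    exact absurd hcontact (not_lt.2 (hkmin _ (not_le.1 hlt)))
  have hkq' : q ^ 2 - q < k := by
    by_contra hle
    exact absurd hk (not_lt.2 (symGap_before_contact hq hh (not_lt.1 hle) fun j _ => rfl))
  have hkR : (k : ℝ) ≤ (q : ℝ) ^ 2 := by exact_mod_cast hkq
  have hkR' : (q : ℝ) ^ 2 ≤ k + q := by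
    have : q ^ 2 ≤ k + q := by omega
    exact_mod_cast this
  have htk : t k = k * h := rfl
  have hk1 : t k ≤ 1 / 100 := by rw [htk, ← p1]; gcongr
  have hk2 : 1 / 100 - q * h ≤ t k := by
    rw [htk, ← p1]
    linarith [mul_le_mul_of_nonneg_right hkR' p0.le]
  have g0 : ∀ j < k, 0 ≤ t (j + 1) - t j := fun j _ => by rw [hd j]; exact p0.le
  have g1 : ∀ j < k, t (j + 1) - t j ≤ 1 / 700 := fun j _ => by rw [hd j]; exact p4
  obtain ⟨hX, hfield⟩ := eulerSeq_eq_symConf hp.start_eq g0 g1 hkmin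
  have hw : 99 / 100 ≤ decay 2 t k := by
    refine le_trans ?_ (le_decay_two hp.start_eq g0 g1)
    have e1 : 1 ≤ Real.exp (2 * contactTime - 2 * t k) := by
      rw [Real.one_le_exp_iff, contactTime_eq]
      linarith
    have e2 : 99 / 100 ≤ 1 - 4 * sqStep t k := by
      rw [sqStep_of_uniform (t := t) (k := k) (h := h) fun j _ => rfl]
      rw [htk] at hk1
      nlinarith
    exact le_trans (by norm_num) (mul_le_mul e1 e2 (by norm_num) (Real.exp_pos _).le)
  have hw' : decay 2 t k ≤ 101 / 100 := by
    refine (decay_le hp.start_eq fun j hj => by linarith [g1 j hj]).trans ?_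
    refine (Real.exp_le_exp.2 (show _ ≤ 1 / 1000 by rw [contactTime_eq]; linarith)).trans ?_
    refine (Real.exp_bound_div_one_sub_of_interval (by norm_num) (by norm_num)).trans ?_
    norm_num
  have hv' : decay 8 t k ≤ 6 / 5 := by
    refine (decay_le hp.start_eq fun j hj => by linarith [g1 j hj]).trans ?_
    refine (Real.exp_le_exp.2 ?_).trans exp_two_twenty_fifths_lt.le
    rw [contactTime_eq]
    linarith
  refine ⟨k, by omega, ?_, fun j hj => ?_, fun j hkj hjm => ?_⟩
  · refine lt_of_le_of_lt ?_ hσε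
    rw [contactTime_eq, abs_le]
    constructor <;> linarith
  · rw [eulerCurve_grid _ _ hp (by omega)]
    exact hfield j hj
  · rw [eulerCurve_grid _ _ hp hjm.le]
    obtain ⟨i, rfl⟩ := Nat.exists_eq_add_of_le hkj
    refine originalField_eulerSeq_after_contact p0.le (by linarith) (fun j _ => hd j) hX hw hw'
      (decay_nonneg fun j hj => by linarith [g1 j hj]) hv' hk i ?_
    -- The grid has at most `2 * q ^ 2` steps, so `i * h ≤ 1 / 50`.
    have : (i : ℝ) ≤ 2 * (q : ℝ) ^ 2 := by
      have : i ≤ 2 * q ^ 2 := by omega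
      exact_mod_cast this
    linarith [mul_le_mul_of_nonneg_right this p0.le]

end

end HK

theorem mainTheorem9 :
    -- three agents, variant model: two distinct CLSS solutions
    (∀ T : ℝ, Real.log 3 / 2 < T →
      ∃ x y : ℝ → Fin 3 → Plane,
        x 0 = threeInit ∧ y 0 = threeInit ∧
        IsCLSS variantField T x ∧ IsCLSS variantField T y ∧
        ¬ EqOn x y (Icc 0 T)) ∧
    -- three agents, original model: a single CLSS solution
    (∀ T : ℝ, 0 < T →
      ∃ x : ℝ → Fin 3 → Plane,
        x 0 = threeInit ∧ IsCLSS originalField T x ∧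
        ∀ y : ℝ → Fin 3 → Plane,
          y 0 = threeInit → IsCLSS originalField T y → EqOn y x (Icc 0 T)) ∧
    -- ten agents, original model
    trajX 0 = tenInit ∧
    (∀ S : ℝ, 0 < S →
      IsClassical originalField S trajX ∧ IsCaratheodory originalField S trajX) ∧
    ∃ Y : ℝ → Fin 4 → Plane, IsClusterFlow Y ∧
      ∀ r : ℕ, 1 ≤ r →
        trajY Y 0 = tenInit ∧
        IsCaratheodory originalField (horizon r) (trajY Y) ∧
        IsCLSS originalField (horizon r) trajX ∧
        IsCLSS originalField (horizon r) (trajY Y) ∧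
        ¬ EqOn trajX (trajY Y) (Icc 0 (horizon r)) ∧
        -- the two sample-and-hold sequences: `K = q²` with `q = r * (σ + 3)`, `Δt = T / K`
        (∃ ys : ℕ → ℝ → Fin 10 → Plane,
          (∀ σ, ys σ 0 = tenInit ∧
            IsSampleAndHold originalField (horizon r) ((r + 1) * r * (σ + 3) ^ 2)
              (uniformGrid (contactTime / ((r * (σ + 3) : ℕ) : ℝ) ^ 2)) (ys σ)) ∧
          TendstoUniformlyOn ys (trajY Y) atTop (Icc 0 (horizon r))) ∧
        (∃ xs : ℕ → ℝ → Fin 10 → Plane,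
          (∀ σ, xs σ 0 = tenInit ∧
            IsSampleAndHold originalField (horizon r)
              ((r + 1) * r * (σ + 3) ^ 2 - 4 * (r * (σ + 3)) + 1)
              (jumpGrid (contactTime / ((r * (σ + 3) : ℕ) : ℝ) ^ 2) (r * (σ + 3))) (xs σ)) ∧
          TendstoUniformlyOn xs trajX atTop (Icc 0 (horizon r))) := by
  refine ⟨three_agents_variant, three_agents_original, trajX_zero,
    fun S hS => ⟨isClassical_trajX S, isCaratheodory_trajX hS⟩, flowY, isClusterFlow_flowY,
    fun r hr => ?_⟩
  obtain ⟨hτ, hτ'⟩ := horizon_bounds hr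
  have hT : 0 < contactTime := by rw [contactTime_eq]; norm_num
  have h0 : trajY flowY 0 = tenInit := (trajY_of_le hT.le).trans trajX_zero
  have hpu := fun σ : ℕ => isPartition_uniformGrid (s := σ + 3) hr (by omega)
  have hpj := fun σ : ℕ => isPartition_jumpGrid (s := σ + 3) hr (by omega)
  have hu := fun σ => isSampleAndHold_eulerCurve originalField tenInit (hpu σ)
  have hj := fun σ => isSampleAndHold_eulerCurve originalField tenInit (hpj σ)
  have hu0 := fun σ => eulerCurve_zero originalField tenInit (hpu σ)
  have hj0 := fun σ => eulerCurve_zero originalField tenInit (hpj σ)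
  obtain ⟨hum, hul⟩ := tendstoUniformlyOn_uniformGrid hr
  obtain ⟨hjm, hjl⟩ := tendstoUniformlyOn_jumpGrid hr
  refine ⟨h0, isCaratheodory_trajY (hT.trans hτ).le hτ',
    ⟨continuous_trajX.continuousOn, _, _, _, hj, fun σ => (hj0 σ).trans trajX_zero.symm, hjm, hjl⟩,
    ⟨continuous_trajY.continuousOn, _, _, _, hu, fun σ => (hu0 σ).trans h0.symm, hum, hul⟩,
    fun h => trajX_ne_trajY hτ (h ⟨(hT.trans hτ).le, le_rfl⟩),
    ⟨_, fun σ => ⟨hu0 σ, hu σ⟩, hul⟩, ⟨_, fun σ => ⟨hj0 σ, hj σ⟩, hjl⟩⟩
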